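/- There are an algorithm and a constant $C$ such that for every $n\ge 1$ and every simple graph $G$ on the vertex set $\{0,\dots,n-1\}$, given by $n$ and its adjacency matrix, the algorithm halts on $G$ after at most $C\,n^4$ steps, and, if $G$ has diameter at most $3$ (that is, any two vertices are joined by a path of length at most $3$ in $G$), then it answers YES when $G$ admits a tree $3$-spanner and NO when $G$ does not. Here a tree $3$-spanner of $G$ is a subgraph $T$ of $G$ that is a tree and satisfies $d_T(u,v)\le 3\,d_G(u,v)$ for all vertices $u,v$ of $G$. An algorithm is a program, the same for all inputs, for a word RAM in which each elementary operation (constants, register access, memory access, addition, truncated subtraction, multiplication, comparison, assignment, test) costs one step, and in which all numbers occurring during the computation are less than $(n+1)^k$ for a constant $k$ that depends only on the program, that is, they fit into words of $O(\log n)$ bits. -/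

import Mathlib

namespace TreeSpanner

/-- `T` is a tree `t`-spanner of `G`: a tree contained in `G` on the vertex set of `G` such that every
two vertices at distance `d` in `G` are at distance at most `t * d` in `T`. Since `T` is connected and
contained in `G`, no distance in this condition is a default value. -/
def IsTreeSpanner {V : Type*} (t : ℕ) (T G : SimpleGraph V) : Prop :=
  T ≤ G ∧ T.IsTree ∧ ∀ u v : V, T.dist u v ≤ t * G.dist u v

/-- `G` admits a tree `t`-spanner. -/
def AdmitsTreeSpanner {V : Type*} (t : ℕ) (G : SimpleGraph V) : Prop :=
  ∃ T : SimpleGraph V, IsTreeSpanner t T G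

end TreeSpanner

/-! A word RAM, programmed in a structured language: finitely many named registers, a random access
memory addressed by computed values, unit cost for every elementary operation, and a bound on the
numbers that may occur. -/

namespace WordRAM

/-- The elementary binary operations on words. -/
inductive Op : Type
  | add
  | sub
  | mul
  | lt
  | eq

/-- The value of an elementary operation: subtraction is truncated at `0`, comparisons give `1` for
true and `0` for false. -/
def Op.apply : Op → ℕ → ℕ → ℕ
  | .add, a, b => a + b
  | .sub, a, b => a - b
  | .mul, a, b => a * b
  | .lt, a, b => if a < b then 1 else 0
  | .eq, a, b => if a = b then 1 else 0

/-- Contents of the registers and of the memory cells. -/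
@[ext]
structure State : Type where
  reg : ℕ → ℕ
  mem : ℕ → ℕ

/-- Expressions: a constant, the content of a register, the content of the memory cell whose address
is given by an expression, or an elementary operation. -/
inductive Expr : Type
  | const (c : ℕ)
  | reg (r : ℕ)
  | load (a : Expr)
  | bin (o : Op) (a b : Expr)

/-- The value of an expression in a state. -/
def Expr.eval (s : State) : Expr → ℕ
  | .const c => c
  | .reg r => s.reg r
  | .load a => s.mem (a.eval s)
  | .bin o a b => o.apply (a.eval s) (b.eval s)

/-- The number of steps needed to evaluate an expression: one for each constant, register access,
memory access and elementary operation in it. -/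
def Expr.cost : Expr → ℕ
  | .const _ => 1
  | .reg _ => 1
  | .load a => a.cost + 1
  | .bin _ a b => a.cost + b.cost + 1

/-- All values that occur in the evaluation of an expression are less than `W`, that is, they fit
into machine words. -/
def Expr.Fits (W : ℕ) (s : State) : Expr → Prop
  | .const c => c < W
  | .reg r => s.reg r < W
  | .load a => a.Fits W s ∧ s.mem (a.eval s) < W
  | .bin o a b => a.Fits W s ∧ b.Fits W s ∧ o.apply (a.eval s) (b.eval s) < W

/-- Programs. -/
inductive Prog : Type
  /-- Do nothing. -/
  | skip
  /-- Put the value of `e` into register `r`. -/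
  | assign (r : ℕ) (e : Expr)
  /-- Put the value of `e` into the memory cell whose address is the value of `a`. -/
  | store (a e : Expr)
  /-- Run `p`, then `q`. -/
  | seq (p q : Prog)
  /-- Run `p` if the value of `e` is nonzero, otherwise run `q`. -/
  | ite (e : Expr) (p q : Prog)
  /-- Run `p` as long as the value of `e` is nonzero. -/
  | loop (e : Expr) (p : Prog)

/-- `Run W p s t s'`: started in state `s`, the program `p` halts in state `s'` after `t` steps, and all
values that occur in the course of the computation are less than `W`. A program that meets a larger
value is stuck: it has no completed run. -/
inductive Run (W : ℕ) : Prog → State → ℕ → State → Prop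
  | skip (s : State) : Run W .skip s 1 s
  | assign (s : State) (r : ℕ) (e : Expr) (he : e.Fits W s) :
      Run W (.assign r e) s (e.cost + 1) ⟨Function.update s.reg r (e.eval s), s.mem⟩
  | store (s : State) (a e : Expr) (ha : a.Fits W s) (he : e.Fits W s) :
      Run W (.store a e) s (a.cost + e.cost + 1)
        ⟨s.reg, Function.update s.mem (a.eval s) (e.eval s)⟩
  | seq {p q : Prog} {s s₁ s₂ : State} {t₁ t₂ : ℕ} (hp : Run W p s t₁ s₁) (hq : Run W q s₁ t₂ s₂) :
      Run W (.seq p q) s (t₁ + t₂) s₂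
  | ite_true {e : Expr} {p q : Prog} {s s' : State} {t : ℕ} (hf : e.Fits W s) (he : e.eval s ≠ 0)
      (hp : Run W p s t s') : Run W (.ite e p q) s (e.cost + 1 + t) s'
  | ite_false {e : Expr} {p q : Prog} {s s' : State} {t : ℕ} (hf : e.Fits W s) (he : e.eval s = 0)
      (hq : Run W q s t s') : Run W (.ite e p q) s (e.cost + 1 + t) s'
  | loop_true {e : Expr} {p : Prog} {s s₁ s₂ : State} {t₁ t₂ : ℕ} (hf : e.Fits W s)
      (he : e.eval s ≠ 0) (hp : Run W p s t₁ s₁) (hl : Run W (.loop e p) s₁ t₂ s₂) :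
      Run W (.loop e p) s (e.cost + 1 + t₁ + t₂) s₂
  | loop_false {e : Expr} {p : Prog} {s : State} (hf : e.Fits W s) (he : e.eval s = 0) :
      Run W (.loop e p) s (e.cost + 1) s

open Classical in
/-- The initial state on input a graph `G` with vertices `0, …, n - 1`: register `0` holds `n`, memory
cell `i * n + j` holds the entry `(i, j)` of the adjacency matrix for `i, j < n`, and all other
registers and memory cells hold `0`. -/
noncomputable def inputState {n : ℕ} (G : SimpleGraph (Fin n)) : State where
  reg := fun r => if r = 0 then n else 0
  mem := fun a => if ∃ i j : Fin n, a = i.val * n + j.val ∧ G.Adj i j then 1 else 0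

end WordRAM

/-!
A tree 3-spanner `T` of a graph `G` of diameter at most 3 determines an edge `uv` of `T` such that every
vertex can be attached to its own side of `uv` within distance 2. Call a branch of `T` at `u`, with first
vertex `b`, bad if it contains a vertex other than `b` that is adjacent in `G` to neither `u` nor `b`.
Such a vertex has all its `G`-neighbours within the branch. A path of length at most 3 in `G` between two
such vertices in different branches at `u` would therefore have a middle edge joining the two branches;
since `T` stretches this edge to at most 3, one of its ends is the first vertex of its branch, which is
excluded. So every vertex has at most one bad branch (`BadBranch.unique`). Directing every vertex towards
its bad branch, one finds an edge `uv` that is traversed both ways (`exists_two_cycle`), and no other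
branch at `u` or `v` is bad.

For a fixed edge `uv`, the vertices have to be divided into the sides of `u` and `v` such that an edge
between the sides joins a neighbour of `u` to a neighbour of `v` (or contains `u` or `v`), and such that
on the side of `u` every component of the non-neighbours of `u` is dominated by a neighbour of `u` other
than `v`, and likewise for `v`. The first condition is a system of implications "if `y` is on the side of
`v`, then so is `w`" (`Pull`), and the second one forces certain vertices to one side (`Repelled`), because
the implications keep dominated components together with their dominators. Hence a division exists if and
only if the closure of the vertices repelled by `u` contains no vertex repelled by `v` (`Central`). A
central edge yields a tree 3-spanner (`Central.admitsTreeSpanner`), and the edge `uv` found above is central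
(`exists_central_of_isTreeSpanner`).

The algorithm tabulates in `n ^ 4` steps which vertices dominate which components, and then tests every
pair `uv` in `n ^ 2` steps, computing the closure with marks on the vertices. It is written in a small
language of counted loops, for which running time and word size can be read off from the text of the
program (`Cmd.run_compile`), so that only its effect `Cmd.exec` on the state is left to be analysed.
-/

/-! ### Branches of a tree -/

namespace TreeSpanner

open SimpleGraph Relation

variable {V : Type*} {G T : SimpleGraph V} {u v b c x y : V}

/-- The branch of `T` at `u` towards the neighbour `b`: the vertices that can still be reached from `b`
once the edge `ub` has been deleted. -/
def Branch (T : SimpleGraph V) (u b : V) : Set V :=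
  {x | (T.deleteEdges {s(u, b)}).Reachable b x}

lemma self_mem_branch (T : SimpleGraph V) (u b : V) : b ∈ Branch T u b := Reachable.refl _

lemma root_notMem_branch (hT : T.IsTree) (h : T.Adj u b) : u ∉ Branch T u b := fun hu =>
  isBridge_iff.1 (isAcyclic_iff_forall_adj_isBridge.1 hT.isAcyclic h) hu.symm

/-- The only tree edge that leaves the branch is `bu`. -/
lemma eq_of_adj_of_mem_branch (hT : T.IsTree) (h : T.Adj u b) (hxy : T.Adj x y)
    (hx : x ∈ Branch T u b) (hy : y ∉ Branch T u b) : x = b ∧ y = u := by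
  by_cases he : s(x, y) = s(u, b)
  · rcases Sym2.eq_iff.1 he with ⟨rfl, rfl⟩ | ⟨rfl, rfl⟩
    · exact absurd hx (root_notMem_branch hT h)
    · exact ⟨rfl, rfl⟩
  · refine absurd (Reachable.trans hx (Adj.reachable ?_)) hy
    simpa [deleteEdges_adj, hxy] using he

lemma dist_le_length_of_mem_branch (hT : T.IsTree) (h : T.Adj u b) (p : T.Walk x y)
    (hx : x ∈ Branch T u b) (hy : y ∉ Branch T u b) :
    T.dist x b + 1 + T.dist u y ≤ p.length := by
  induction p with
  | nil => exact absurd hx hy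
  | @cons x z y hxz p ih =>
    rw [Walk.length_cons]
    by_cases hz : z ∈ Branch T u b
    · have h1 := ih hz hy
      have h2 := hT.connected.dist_triangle (u := x) (v := z) (w := b)
      rw [dist_eq_one_iff_adj.2 hxz] at h2
      omega
    · obtain ⟨rfl, rfl⟩ := eq_of_adj_of_mem_branch hT h hxz hx hz
      have := dist_le p
      simp only [dist_self]
      omega

lemma dist_le_dist_of_mem_branch (hT : T.IsTree) (h : T.Adj u b)
    (hx : x ∈ Branch T u b) (hy : y ∉ Branch T u b) :
    T.dist x b + 1 + T.dist u y ≤ T.dist x y := by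
  obtain ⟨p, hp⟩ := hT.connected.exists_walk_length_eq_dist x y
  exact hp ▸ dist_le_length_of_mem_branch hT h p hx hy

lemma notMem_branch_of_ne (hT : T.IsTree) (hb : T.Adj u b) (hc : T.Adj u c) (hbc : b ≠ c)
    (hx : x ∈ Branch T u b) : x ∉ Branch T u c := by
  intro hx'
  have hcb : c ∉ Branch T u b := fun h =>
    hbc (eq_of_adj_of_mem_branch hT hb hc.symm h (root_notMem_branch hT hb)).1.symm
  have h1 := dist_le_dist_of_mem_branch hT hb hx hcb
  have h2 := dist_le_dist_of_mem_branch hT hc hx' (root_notMem_branch hT hc)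
  have h3 := dist_le_dist_of_mem_branch hT hb hx (root_notMem_branch hT hb)
  have h4 := hT.connected.dist_triangle (u := x) (v := b) (w := u)
  rw [dist_eq_one_iff_adj.2 hb.symm] at h4
  rw [dist_eq_one_iff_adj.2 hc] at h1
  omega

/-- Deleting the edge `uv` cuts the tree into the two branches at its ends. -/
lemma mem_branch_or_mem_branch (hT : T.IsTree) (h : T.Adj u v) (x : V) :
    x ∈ Branch T u v ∨ x ∈ Branch T v u := by
  by_contra! hx
  have h1 := dist_le_dist_of_mem_branch hT h (self_mem_branch T u v) hx.1
  have h2 := dist_le_dist_of_mem_branch hT h.symm (self_mem_branch T v u) hx.2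
  omega

lemma notMem_branch_swap (hT : T.IsTree) (h : T.Adj u v) (hx : x ∈ Branch T u v) :
    x ∉ Branch T v u := by
  intro hx'
  have h1 := dist_le_dist_of_mem_branch hT h hx (root_notMem_branch hT h)
  have h2 := dist_le_dist_of_mem_branch hT h.symm hx' (root_notMem_branch hT h.symm)
  omega

lemma exists_mem_branch (hT : T.IsTree) (h : x ≠ u) : ∃ b, T.Adj u b ∧ x ∈ Branch T u b := by
  obtain ⟨p, hp⟩ := hT.connected.exists_walk_length_eq_dist u x
  cases p with
  | nil => exact absurd rfl h
  | @cons _ b _ hub q =>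
    refine ⟨b, hub, by_contra fun hx => ?_⟩
    have h1 := dist_le_dist_of_mem_branch hT hub (self_mem_branch T u b) hx
    have h2 := dist_le q
    rw [Walk.length_cons] at hp
    simp only [dist_self] at h1
    omega

/-- An orientation of a tree that points from every vertex to a neighbour runs back along some edge. -/
lemma exists_two_cycle [Finite V] (hT : T.IsTree) (f : V → V) (hf : ∀ u, T.Adj u (f u)) :
    ∃ u, f (f u) = u := by
  have := hT.connected.nonempty
  -- an edge whose branch is smallest
  obtain ⟨u, hu⟩ := Finite.exists_min fun u => (Branch T u (f u)).ncard
  refine ⟨u, by_contra fun hne => (hu (f u)).not_gt ?_⟩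
  refine Set.ncard_lt_ncard ⟨fun x hx => ?_, fun hsub => ?_⟩ (Set.toFinite _)
  · exact (mem_branch_or_mem_branch hT (hf u) x).resolve_right
      (notMem_branch_of_ne hT (hf _) (hf u).symm hne hx)
  · exact root_notMem_branch hT (hf (f u)) (hsub (self_mem_branch T u (f u)))

/-! ### Central edges -/

/-- One step inside the graph induced on the vertices that are neither `u` nor adjacent to `u`. -/
def Away (G : SimpleGraph V) (u y w : V) : Prop := G.Adj y w ∧ w ≠ u ∧ ¬ G.Adj u w

/-- Some neighbour of `u` other than `v` is adjacent to all vertices of the component of `x` in the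
graph induced on the non-neighbours of `u`. -/
def Dominated (G : SimpleGraph V) (u v x : V) : Prop :=
  ∃ a, a ≠ v ∧ G.Adj u a ∧ ∀ y, ReflTransGen (Away G u) x y → G.Adj a y

/-- If `y` is on the side of `v`, then its neighbour `w` has to be on the side of `v`, too: an edge
between the two sides has to join a neighbour of `u` to a neighbour of `v`. -/
def Pull (G : SimpleGraph V) (u v y w : V) : Prop :=
  G.Adj y w ∧ w ≠ u ∧ w ≠ v ∧ (¬ G.Adj u w ∨ ¬ G.Adj v y)

/-- The vertices that cannot be attached to `u` directly or through a dominating neighbour. -/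
def Repelled (G : SimpleGraph V) (u v x : V) : Prop :=
  x ≠ u ∧ ¬ G.Adj u x ∧ ¬ Dominated G u v x

/-- The vertices that are forced to the side of `v`. -/
def Captured (G : SimpleGraph V) (u v x : V) : Prop :=
  ∃ x₀, Repelled G u v x₀ ∧ ReflTransGen (Pull G u v) x₀ x

/-- An edge `uv` is central if all vertices that are forced to the side of `v` can be attached there.
This is what the algorithm tests. -/
def Central (G : SimpleGraph V) (u v : V) : Prop :=
  G.Adj u v ∧ ∀ x, Captured G u v x → ¬ Repelled G v u x

lemma Captured.ne_and_ne (h : G.Adj u v) (hx : Captured G u v x) : x ≠ u ∧ x ≠ v := by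
  obtain ⟨x₀, h0, h1⟩ := hx
  rcases h1.cases_tail with rfl | ⟨y, -, hy⟩
  · exact ⟨h0.1, fun e => h0.2.1 (e ▸ h)⟩
  · exact ⟨hy.2.1, hy.2.2.1⟩

/-! ### A tree 3-spanner of a graph of diameter at most 3 yields a central edge -/

/-- The branch at `u` towards `b` contains a vertex that is adjacent to neither `u` nor `b`. -/
def BadBranch (G T : SimpleGraph V) (u b : V) : Prop :=
  T.Adj u b ∧ ∃ x ∈ Branch T u b, x ≠ b ∧ ¬ G.Adj u x ∧ ¬ G.Adj b x

lemma IsTreeSpanner.dist_le_three (hS : IsTreeSpanner 3 T G) (h : G.Adj x y) : T.dist x y ≤ 3 := by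
  have := hS.2.2 x y
  rwa [dist_eq_one_iff_adj.2 h] at this

/-- A vertex that makes its branch bad has no neighbours outside: an edge leaving the branch from there
would be stretched to more than 3. -/
lemma mem_branch_of_adj (hS : IsTreeSpanner 3 T G) (h : T.Adj u b) (hx : x ∈ Branch T u b)
    (hxb : x ≠ b) (hux : ¬ G.Adj u x) (hbx : ¬ G.Adj b x) (hxy : G.Adj x y) :
    y ∈ Branch T u b := by
  by_contra hy
  have hT := hS.2.1
  have h1 := dist_le_dist_of_mem_branch hT h hx hy
  have h2 := hS.dist_le_three hxy
  have h3 : T.dist x b ≠ 0 := fun h0 => hxb (hT.connected.dist_eq_zero_iff.1 h0)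
  have h4 : T.dist x b ≠ 1 := fun h0 => hbx (hS.1 (dist_eq_one_iff_adj.1 h0)).symm
  have h5 : T.dist u y ≠ 0 := fun h0 => hux (hT.connected.dist_eq_zero_iff.1 h0 ▸ hxy.symm)
  omega

/-- Two bad branches at the same vertex contain vertices at distance more than 3 in `G`. -/
lemma BadBranch.unique (hS : IsTreeSpanner 3 T G) (hG : G.Connected) (hd : ∀ x y, G.dist x y ≤ 3)
    (hb : BadBranch G T u b) (hc : BadBranch G T u c) : b = c := by
  by_contra hbc
  have hT := hS.2.1
  obtain ⟨hub, x, hx, hxb, hux, hbx⟩ := hb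
  obtain ⟨huc, y, hy, hyc, huy, hcy⟩ := hc
  have key : ∀ z, G.Adj x z → z ∈ Branch T u b := fun z =>
    mem_branch_of_adj hS hub hx hxb hux hbx
  have key' : ∀ z, G.Adj y z → z ∈ Branch T u c := fun z =>
    mem_branch_of_adj hS huc hy hyc huy hcy
  have disj : ∀ z, z ∈ Branch T u b → z ∉ Branch T u c := fun z =>
    notMem_branch_of_ne hT hub huc hbc
  obtain ⟨p, hp⟩ := hG.exists_walk_length_eq_dist x y
  have hlen : p.length ≤ 3 := hp ▸ hd x y
  match p, hlen with
  | .nil, _ => exact disj _ hx hy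
  | .cons h .nil, _ => exact disj _ (key _ h) hy
  | .cons h (.cons h' .nil), _ => exact disj _ (key _ h) (key' _ h'.symm)
  | .cons (v := q) h (.cons (v := r) h' (.cons h'' .nil)), _ =>
    have hq := key _ h
    have hr := key' _ h''.symm
    have hr' : r ∉ Branch T u b := fun hr' => disj _ hr' hr
    have h1 := dist_le_dist_of_mem_branch hT hub hq hr'
    have h2 := dist_le_dist_of_mem_branch hT huc hr (root_notMem_branch hT huc)
    have h3 := hS.dist_le_three h'
    rw [dist_comm (u := u) (v := r)] at h1
    -- the middle edge joins the two branches, so one of its ends is `b` or `c`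
    have h4 : T.dist q b ≠ 0 := fun h0 => hbx (hT.connected.dist_eq_zero_iff.1 h0 ▸ h.symm)
    have h5 : T.dist r c ≠ 0 := fun h0 => hcy (hT.connected.dist_eq_zero_iff.1 h0 ▸ h'')
    omega
  | .cons _ (.cons _ (.cons _ (.cons _ _))), hlen =>
    simp only [Walk.length_cons] at hlen
    omega

/-- In a branch that is not bad, every component of non-neighbours of `u` is dominated by `b`. -/
lemma dominated_of_not_badBranch (hS : IsTreeSpanner 3 T G) (h : T.Adj u b) (hbv : b ≠ v)
    (hgood : ¬ BadBranch G T u b) (hx : x ∈ Branch T u b) (hux : ¬ G.Adj u x) :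
    Dominated G u v x := by
  have hT := hS.2.1
  have hub := hS.1 h
  refine ⟨b, hbv, hub, fun y hy => ?_⟩
  have main : y ∈ Branch T u b ∧ ¬ G.Adj u y := by
    induction hy with
    | refl => exact ⟨hx, hux⟩
    | @tail y w _ hyw ih =>
      refine ⟨by_contra fun hw => ?_, hyw.2.2⟩
      have h1 := dist_le_dist_of_mem_branch hT h ih.1 hw
      have h2 := hS.dist_le_three hyw.1
      have h3 : T.dist y b ≠ 0 := fun h0 =>
        ih.2 (hT.connected.dist_eq_zero_iff.1 h0 ▸ hub)
      have h4 : T.dist u w ≠ 0 := fun h0 => hyw.2.1 (hT.connected.dist_eq_zero_iff.1 h0).symm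
      have h5 : T.dist u w ≠ 1 := fun h0 => hyw.2.2 (hS.1 (dist_eq_one_iff_adj.1 h0))
      omega
  by_contra hby
  exact hgood ⟨h, y, main.1, fun e => main.2 (e ▸ hub), main.2, hby⟩

lemma mem_branch_of_repelled (hS : IsTreeSpanner 3 T G)
    (hgood : ∀ b, b ≠ v → ¬ BadBranch G T u b) (hx : Repelled G u v x) : x ∈ Branch T u v := by
  obtain ⟨b, hub, hxb⟩ := exists_mem_branch hS.2.1 hx.1
  by_cases hbv : b = v
  · exact hbv ▸ hxb
  · exact absurd (dominated_of_not_badBranch hS hub hbv (hgood b hbv) hxb hx.2.1) hx.2.2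

/-- Direct every vertex `u` to the bad branch at `u`, if there is one. If `u` and `v` are directed to each
other, then no other branch at `u` or `v` is bad, so the vertices repelled by one end lie on the side of
the other, and `Pull` does not lead across the edge. -/
theorem exists_central_of_isTreeSpanner [Finite V] [Nontrivial V] (hG : G.Connected)
    (hd : ∀ x y, G.dist x y ≤ 3) (hS : IsTreeSpanner 3 T G) : ∃ u v, Central G u v := by
  classical
  have hT := hS.2.1
  have hnb : ∀ u, ∃ b, T.Adj u b := fun u => hT.connected.preconnected.exists_adj_of_nontrivial u
  have hf : ∀ u, ∃ b, T.Adj u b ∧ ∀ c, c ≠ b → ¬ BadBranch G T u c := by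
    intro u
    by_cases h : ∃ b, BadBranch G T u b
    · obtain ⟨b, hb⟩ := h
      exact ⟨b, hb.1, fun c hcb hc => hcb (hc.unique hS hG hd hb)⟩
    · obtain ⟨b, hb⟩ := hnb u
      exact ⟨b, hb, fun c _ hc => h ⟨c, hc⟩⟩
  choose f hf1 hf2 using hf
  obtain ⟨u, hu⟩ := exists_two_cycle hT f hf1
  obtain ⟨v, hv⟩ : ∃ v, v = f u := ⟨_, rfl⟩
  have huv : T.Adj u v := hv ▸ hf1 u
  have hgu : ∀ b, b ≠ v → ¬ BadBranch G T u b := fun b hb => hf2 u b (hv ▸ hb)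
  have hgv : ∀ b, b ≠ u → ¬ BadBranch G T v b := fun b hb => hf2 v b (by rwa [hv, hu])
  refine ⟨u, v, hS.1 huv, ?_⟩
  rintro x ⟨x₀, h0, h01⟩ hx
  have hxu : x ∈ Branch T v u := mem_branch_of_repelled hS hgv hx
  refine notMem_branch_swap hT huv ?_ hxu
  clear hx hxu
  have hx0 := mem_branch_of_repelled hS hgu h0
  have : x ∈ Branch T u v ∧ x ≠ v := by
    induction h01 with
    | refl => exact ⟨hx0, fun e => h0.2.1 (e ▸ hS.1 huv)⟩
    | @tail y w _ hyw ih =>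
      refine ⟨by_contra fun hw => ?_, hyw.2.2.1⟩
      have h1 := dist_le_dist_of_mem_branch hT huv ih.1 hw
      have h2 := hS.dist_le_three hyw.1
      have h3 : T.dist y v ≠ 0 := fun e => ih.2 (hT.connected.dist_eq_zero_iff.1 e)
      have h4 : T.dist u w ≠ 0 := fun e => hyw.2.1 (hT.connected.dist_eq_zero_iff.1 e).symm
      rcases hyw.2.2.2 with h | h
      · have h5 : T.dist u w ≠ 1 := fun e => h (hS.1 (dist_eq_one_iff_adj.1 e))
        omega
      · have h5 : T.dist y v ≠ 1 := fun e => h (hS.1 (dist_eq_one_iff_adj.1 e)).symm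
        omega
  exact this.1

/-! ### A central edge yields a tree 3-spanner -/

/-- The graph that joins every vertex to its parent. -/
def parentGraph (par : V → V) : SimpleGraph V := SimpleGraph.fromRel fun x y => y = par x

/-- A parent graph in which every vertex is joined to the root has too few edges to contain a cycle. -/
lemma isTree_parentGraph [Finite V] (par : V → V) (r : V)
    (hr : par r = r) (hpar : ∀ x, (parentGraph par).Reachable x r) : (parentGraph par).IsTree := by
  classical
  have : Fintype V := Fintype.ofFinite V
  have hconn : (parentGraph par).Connected :=
    { preconnected := fun x y => (hpar x).trans (hpar y).symm
      nonempty := ⟨r⟩ }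
  rw [isTree_iff_connected_and_card]
  refine ⟨hconn, le_antisymm ?_ hconn.card_vert_le_card_edgeSet_add_one⟩
  have hsub : (parentGraph par).edgeSet ⊆ (fun x => s(x, par x)) '' {r}ᶜ := by
    intro e
    induction e with | h x y
    rw [mem_edgeSet]
    rintro ⟨hne, h | h⟩
    · exact ⟨x, fun e => hne (by rw [h, e, hr]), by simp [h]⟩
    · exact ⟨y, fun e => hne (by rw [h, e, hr]), by simp [h, Sym2.eq_swap]⟩
  have h1 := (Set.ncard_le_ncard hsub (Set.toFinite _)).trans (Set.ncard_image_le (Set.toFinite _))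
  have h2 := Set.ncard_add_ncard_compl ({r} : Set V)
  rw [Set.ncard_singleton] at h2
  rw [Nat.card_coe_set_eq]
  omega

/-- A tree in `G` is a tree 3-spanner as soon as it stretches no edge to more than 3. -/
lemma isTreeSpanner_of_adj (hTG : T ≤ G) (hT : T.IsTree)
    (h : ∀ x y, G.Adj x y → T.dist x y ≤ 3) : IsTreeSpanner 3 T G := by
  refine ⟨hTG, hT, fun x y => ?_⟩
  obtain ⟨p, hp⟩ := (hT.connected.mono hTG).exists_walk_length_eq_dist x y
  rw [← hp]
  clear hp
  induction p with
  | nil => simp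
  | @cons x z y hxz p ih =>
    have h1 := h x z hxz
    have h2 := hT.connected.dist_triangle (u := x) (v := z) (w := y)
    rw [Walk.length_cons]
    omega

/-- Two adjacent non-neighbours of `u` lie in the same component. -/
lemma away_component_eq (h : Away G u x y) (h' : Away G u y x) :
    {z | ReflTransGen (Away G u) x z} = {z | ReflTransGen (Away G u) y z} :=
  Set.ext fun _ => ⟨fun hz => .head h' hz, fun hz => .head h hz⟩

/-- A neighbour of `u` other than `v` that is adjacent to all vertices of the component of `x`. It is
chosen as a function of the component, so that all vertices of a component get the same one. -/
noncomputable def dominator (G : SimpleGraph V) (u v x : V) : V :=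
  Classical.epsilon (h := ⟨u⟩) fun a => a ≠ v ∧ G.Adj u a ∧
    ∀ y ∈ {z | ReflTransGen (Away G u) x z}, G.Adj a y

lemma dominator_spec (h : Dominated G u v x) :
    dominator G u v x ≠ v ∧ G.Adj u (dominator G u v x) ∧ G.Adj (dominator G u v x) x := by
  have := Classical.epsilon_spec_aux (h := ⟨u⟩) (fun a => a ≠ v ∧ G.Adj u a ∧
    ∀ y ∈ {z | ReflTransGen (Away G u) x z}, G.Adj a y) h
  exact ⟨this.1, this.2.1, this.2.2 x .refl⟩

lemma dominator_eq (hxy : G.Adj x y) (hxu : x ≠ u) (hyu : y ≠ u) (hux : ¬ G.Adj u x)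
    (huy : ¬ G.Adj u y) : dominator G u v x = dominator G u v y := by
  unfold dominator
  rw [away_component_eq ⟨hxy, hyu, huy⟩ ⟨hxy.symm, hxu, hux⟩]

open Classical in
/-- The parent of a vertex in the tree grown from the central edge `uv`: each vertex is attached to its
own end of the edge, directly if possible and through the dominator of its component otherwise. The
root is `u`. -/
noncomputable def centralParent (G : SimpleGraph V) (u v x : V) : V :=
  if x = u ∨ x = v then u
  else if Captured G u v x then (if G.Adj v x then v else dominator G v u x)
  else if G.Adj u x then u else dominator G u v x

lemma parentGraph_adj {par : V → V} {z : V} (h : par x = z) (hne : x ≠ z) :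
    (parentGraph par).Adj x z := ⟨hne, Or.inl h.symm⟩

lemma adj_parent_of_adj_parentGraph {par : V → V} (h : (parentGraph par).Adj x y) :
    (x ≠ y ∧ y = par x) ∨ (y ≠ x ∧ x = par y) := by
  obtain ⟨hne, h | h⟩ := h
  · exact Or.inl ⟨hne, h⟩
  · exact Or.inr ⟨hne.symm, h⟩

/-- The tree `T` attaches every vertex of `S` to `u`, directly if it is a neighbour of `u` in `G` and
through the dominator of its component otherwise. -/
def Attached (G T : SimpleGraph V) (u v : V) (S : Set V) : Prop :=
  ∀ x ∈ S, x ≠ u → (G.Adj u x → T.Adj x u) ∧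
    (¬ G.Adj u x → T.Adj x (dominator G u v x) ∧ T.Adj (dominator G u v x) u)

lemma Attached.exists_walk {S : Set V} (h : Attached G T u v S) (hx : x ∈ S) :
    ∃ p : T.Walk x u, p.length ≤ 2 := by
  by_cases hxu : x = u
  · subst hxu
    exact ⟨.nil, by simp⟩
  by_cases hux : G.Adj u x
  · exact ⟨.cons ((h x hx hxu).1 hux) .nil, by simp⟩
  · obtain ⟨h1, h2⟩ := (h x hx hxu).2 hux
    exact ⟨.cons h1 (.cons h2 .nil), by simp⟩

lemma Attached.dist_le_two {S : Set V} (h : Attached G T u v S) (hx : x ∈ S) :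
    T.dist x u ≤ 2 := by
  obtain ⟨p, hp⟩ := h.exists_walk hx
  exact (dist_le p).trans hp

lemma Attached.dist_le_one {S : Set V} (h : Attached G T u v S) (hx : x ∈ S) (hux : G.Adj u x) :
    T.dist x u ≤ 1 := (dist_eq_one_iff_adj.2 ((h x hx hux.ne').1 hux)).le

lemma Attached.dist_le_three {S : Set V} (h : Attached G T u v S) (hT : T.Connected) (hx : x ∈ S)
    (hy : y ∈ S) (hxy : G.Adj x y) : T.dist x y ≤ 3 := by
  have tri := hT.dist_triangle (u := x) (v := u) (w := y)
  rw [dist_comm (u := u) (v := y)] at tri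
  have hx2 := h.dist_le_two hx
  have hy2 := h.dist_le_two hy
  by_cases hux : G.Adj u x
  · have := h.dist_le_one hx hux
    omega
  by_cases huy : G.Adj u y
  · have := h.dist_le_one hy huy
    omega
  have hxu : x ≠ u := by
    rintro rfl
    exact huy hxy
  have hyu : y ≠ u := by
    rintro rfl
    exact hux hxy.symm
  have h1 := ((h x hx hxu).2 hux).1
  have h2 := ((h y hy hyu).2 huy).1
  rw [← dominator_eq hxy hxu hyu hux huy] at h2
  exact (dist_le (Walk.cons h1 (.cons h2.symm .nil))).trans (by simp)

/-- The tree of `centralParent` stretches no edge to more than 3: edges within a component of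
non-neighbours of `u` are bridged by the common dominator, edges between the two sides by `uv`. -/
theorem Central.admitsTreeSpanner [Finite V] (h : Central G u v) : AdmitsTreeSpanner 3 G := by
  classical
  obtain ⟨huv, hc⟩ := h
  set par := centralParent G u v with hpar
  set T := parentGraph par with hT
  have hparu : par u = u := by simp [hpar, centralParent]
  have hTuv : T.Adj v u := parentGraph_adj (by simp [hpar, centralParent]) huv.ne'
  have cap_of_adj : ∀ x y, Captured G u v x → G.Adj x y → y ≠ u → y ≠ v →
      (¬ G.Adj u y ∨ ¬ G.Adj v x) → Captured G u v y := fun x y ⟨x₀, h0, h1⟩ hxy hyu hyv hor =>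
    ⟨x₀, h0, h1.tail ⟨hxy, hyu, hyv, hor⟩⟩
  have hnu : ¬ Captured G u v u := fun h => (h.ne_and_ne huv).1 rfl
  have hnv : ¬ Captured G u v v := fun h => (h.ne_and_ne huv).2 rfl
  have domU : ∀ x, ¬ Captured G u v x → x ≠ u → ¬ G.Adj u x → Dominated G u v x :=
    fun x hx hxu hux => by_contra fun hd => hx ⟨x, ⟨hxu, hux, hd⟩, .refl⟩
  have domV : ∀ x, Captured G u v x → ¬ G.Adj v x → Dominated G v u x :=
    fun x hx hvx => by_contra fun hd => hc x hx ⟨(hx.ne_and_ne huv).2, hvx, hd⟩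
  have parU : ∀ x, ¬ Captured G u v x → x ≠ u → x ≠ v → par x =
      if G.Adj u x then u else dominator G u v x := fun x hx hxu hxv => by
    simp [hpar, centralParent, hx, hxu, hxv]
  have parV : ∀ x, Captured G u v x → par x =
      if G.Adj v x then v else dominator G v u x := fun x hx => by
    simp [hpar, centralParent, hx, (hx.ne_and_ne huv).1, (hx.ne_and_ne huv).2]
  have hAU : Attached G T u v {x | ¬ Captured G u v x ∧ x ≠ v} := by
    rintro x ⟨hx, hxv⟩ hxu
    refine ⟨fun hux => parentGraph_adj (by rw [parU x hx hxu hxv, if_pos hux]) hxu, fun hux => ?_⟩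
    obtain ⟨hdv, hud, hdx⟩ := dominator_spec (domU x hx hxu hux)
    refine ⟨parentGraph_adj (by rw [parU x hx hxu hxv, if_neg hux]) hdx.ne', ?_⟩
    have hd : ¬ Captured G u v (dominator G u v x) := fun hd =>
      hx (cap_of_adj _ _ hd hdx hxu hxv (Or.inl hux))
    exact parentGraph_adj (by rw [parU _ hd hud.ne' hdv, if_pos hud]) hud.ne'
  have hAV : Attached G T v u {x | Captured G u v x ∨ x = v} := by
    rintro x (hx | hx) hxv
    swap
    · exact absurd hx hxv
    refine ⟨fun hvx => parentGraph_adj (by rw [parV x hx, if_pos hvx]) hxv, fun hvx => ?_⟩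
    obtain ⟨hdu, hvd, hdx⟩ := dominator_spec (domV x hx hvx)
    refine ⟨parentGraph_adj (by rw [parV x hx, if_neg hvx]) hdx.ne', ?_⟩
    have hd : Captured G u v (dominator G v u x) :=
      cap_of_adj _ _ hx hdx.symm hdu hvd.ne' (Or.inr hvx)
    exact parentGraph_adj (by rw [parV _ hd, if_pos hvd]) hvd.ne'
  have side : ∀ x, (¬ Captured G u v x ∧ x ≠ v) ∨ (Captured G u v x ∨ x = v) := fun x => by tauto
  have htree : T.IsTree := by
    refine isTree_parentGraph par u hparu fun x => ?_
    rcases side x with hx | hx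
    · obtain ⟨p, -⟩ := hAU.exists_walk hx
      exact p.reachable
    · obtain ⟨p, -⟩ := hAV.exists_walk hx
      exact p.reachable.trans hTuv.reachable
  have hTG : T ≤ G := by
    have main : ∀ x, x ≠ par x → G.Adj x (par x) := by
      intro x hx
      by_cases hxu : x = u
      · exact absurd (hxu ▸ hparu.symm) hx
      by_cases hxv : x = v
      · subst hxv
        simpa [hpar, centralParent] using huv.symm
      by_cases hcap : Captured G u v x
      · rw [parV x hcap]
        split_ifs with hvx
        · exact hvx.symm
        · exact (dominator_spec (domV x hcap hvx)).2.2.symm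
      · rw [parU x hcap hxu hxv]
        split_ifs with hux
        · exact hux.symm
        · exact (dominator_spec (domU x hcap hxu hux)).2.2.symm
    intro x y hxy
    rcases adj_parent_of_adj_parentGraph hxy with ⟨hne, rfl⟩ | ⟨hne, rfl⟩
    · exact main x hne
    · exact (main y hne).symm
  refine ⟨T, isTreeSpanner_of_adj hTG htree ?_⟩
  have hcon := htree.connected
  have cross : ∀ x y, (¬ Captured G u v x ∧ x ≠ v) → (Captured G u v y ∨ y = v) → G.Adj x y →
      T.dist x y ≤ 3 := by
    intro x y hx hy hxy
    have t1 := hcon.dist_triangle (u := x) (v := u) (w := y)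
    have t2 := hcon.dist_triangle (u := u) (v := v) (w := y)
    have h2 := dist_eq_one_iff_adj.2 hTuv.symm
    rw [dist_comm (u := v) (v := y)] at t2
    have hx2 := hAU.dist_le_two hx
    have hy2 := hAV.dist_le_two hy
    by_cases hxu : x = u
    · have : T.dist x u = 0 := by simp [hxu]
      omega
    by_cases hyv : y = v
    · have : T.dist y v = 0 := by simp [hyv]
      omega
    have hycap := hy.resolve_right hyv
    have hor : ¬ (¬ G.Adj u x ∨ ¬ G.Adj v y) := fun hor =>
      hx.1 (cap_of_adj y x hycap hxy.symm hxu hx.2 hor)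
    push Not at hor
    have hx1 := hAU.dist_le_one hx hor.1
    have hy1 := hAV.dist_le_one hy hor.2
    omega
  intro x y hxy
  rcases side x with hx | hx <;> rcases side y with hy | hy
  · exact hAU.dist_le_three hcon hx hy hxy
  · exact cross x y hx hy hxy
  · rw [dist_comm]
    exact cross y x hy hx hxy.symm
  · exact hAV.dist_le_three hcon hx hy hxy

end TreeSpanner

/-! ### Programs with counted loops -/

namespace WordRAM

/-- Programs whose loops are all of the form "for `r` from `0` to `n - 1`", where `n` is the content of
register `0`. -/
inductive Cmd : Type
  | assign (r : ℕ) (e : Expr)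
  | store (a e : Expr)
  | seq (c d : Cmd)
  | ite (e : Expr) (c d : Cmd)
  | skip
  | iter (r : ℕ) (c : Cmd)

/-- Put the value `v` into register `r`. -/
def State.set (s : State) (r v : ℕ) : State := ⟨Function.update s.reg r v, s.mem⟩

/-- Put the value `v` into memory cell `a`. -/
def State.write (s : State) (a v : ℕ) : State := ⟨s.reg, Function.update s.mem a v⟩

/-- The state after `k` rounds of a loop with counter `r` and body `f`: the counter holds `k`. -/
def iterTo (f : State → State) (r : ℕ) (s : State) : ℕ → State
  | 0 => s.set r 0
  | k + 1 => (f (iterTo f r s k)).set r (k + 1)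

namespace Cmd

/-- The effect of a command. -/
def exec : Cmd → State → State
  | assign r e, s => s.set r (e.eval s)
  | store a e, s => s.write (a.eval s) (e.eval s)
  | seq c d, s => d.exec (c.exec s)
  | ite e c d, s => if e.eval s ≠ 0 then c.exec s else d.exec s
  | skip, s => s
  | iter r c, s => iterTo c.exec r s (s.reg 0)

/-- The RAM program of a command. -/
def compile : Cmd → Prog
  | assign r e => .assign r e
  | store a e => .store a e
  | seq c d => .seq c.compile d.compile
  | ite e c d => .ite e c.compile d.compile
  | skip => .skip
  | iter r c => .seq (.assign r (.const 0)) (.loop (.bin .lt (.reg r) (.reg 0))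
      (.seq c.compile (.assign r (.bin .add (.reg r) (.const 1)))))

/-- The registers that a command may change. -/
def writes : Cmd → List ℕ
  | assign r _ => [r]
  | store _ _ => []
  | seq c d => c.writes ++ d.writes
  | ite _ c d => c.writes ++ d.writes
  | skip => []
  | iter r c => r :: c.writes

/-- An expression whose value never exceeds both `2` and all register and memory contents. -/
def small : Expr → Bool
  | .const c => c ≤ 2
  | .reg _ => true
  | .load _ => true
  | .bin .lt _ _ => true
  | .bin .eq _ _ => true
  | .bin _ _ _ => false

/-- Register `0` is never changed, loop counters are changed by their loops only, and only small values
are put into registers and memory cells. -/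
def ok : Cmd → Bool
  | assign r e => r ≠ 0 && small e
  | store _ e => small e
  | seq c d => c.ok && d.ok
  | ite _ c d => c.ok && d.ok
  | skip => true
  | iter r c => r ≠ 0 && r ∉ c.writes && c.ok

/-- The number of nested loops. -/
def depth : Cmd → ℕ
  | assign _ _ => 0
  | store _ _ => 0
  | seq c d => max c.depth d.depth
  | ite _ c d => max c.depth d.depth
  | skip => 0
  | iter _ c => c.depth + 1

/-- The coefficient in the bound `c.size * n ^ c.depth` for the running time. -/
def size : Cmd → ℕ
  | assign _ e => e.cost + 1
  | store a e => a.cost + e.cost + 1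
  | seq c d => c.size + d.size
  | ite e c d => e.cost + 1 + c.size + d.size
  | skip => 1
  | iter _ c => c.size + 14

end Cmd

/-- If all registers and memory cells are at most `n + 1`, then the value of `e` is at most
`(n + 1) ^ e.weight`. -/
def Expr.weight : Expr → ℕ
  | .const c => c + 1
  | .reg _ => 1
  | .load a => a.weight + 1
  | .bin _ a b => a.weight + b.weight

/-- A bound for the weights of all expressions in the program of a command. -/
def Cmd.weight : Cmd → ℕ
  | .assign _ e => e.weight
  | .store a e => a.weight + e.weight
  | .seq c d => c.weight + d.weight
  | .ite e c d => e.weight + c.weight + d.weight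
  | .skip => 0
  | .iter _ c => c.weight + 3

/-- All registers and memory cells hold at most `n + 1`. -/
def State.Bounded (n : ℕ) (s : State) : Prop :=
  (∀ r, s.reg r ≤ n + 1) ∧ ∀ a, s.mem a ≤ n + 1

lemma State.Bounded.set {n : ℕ} {s : State} (h : s.Bounded n) {v : ℕ} (hv : v ≤ n + 1) (r : ℕ) :
    (s.set r v).Bounded n := by
  refine ⟨fun r' => ?_, h.2⟩
  by_cases hr : r' = r
  · simpa [State.set, hr] using hv
  · simpa [State.set, hr] using h.1 r'

lemma State.Bounded.write {n : ℕ} {s : State} (h : s.Bounded n) {v : ℕ} (hv : v ≤ n + 1) (a : ℕ) :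
    (s.write a v).Bounded n := by
  refine ⟨h.1, fun a' => ?_⟩
  by_cases hr : a' = a
  · simpa [State.write, hr] using hv
  · simpa [State.write, hr] using h.2 a'

@[simp] lemma set_reg_self (s : State) (r v : ℕ) : (s.set r v).reg r = v := by simp [State.set]

lemma set_reg_of_ne (s : State) {r r' : ℕ} (v : ℕ) (h : r' ≠ r) :
    (s.set r v).reg r' = s.reg r' := by simp [State.set, h]

@[simp] lemma write_reg (s : State) (a v : ℕ) : (s.write a v).reg = s.reg := rfl

lemma Expr.one_le_weight (e : Expr) : 1 ≤ e.weight := by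
  induction e with
  | const c => simp [weight]
  | reg r => simp [weight]
  | load a ih => simp [weight]
  | bin o a b iha ihb => simp only [weight]; omega

lemma Op.apply_le {B x y : ℕ} (hB : 2 ≤ B) (hx : x ≤ B) {C : ℕ} (hC : 2 ≤ C) (hy : y ≤ C) (o : Op) :
    o.apply x y ≤ B * C := by
  have h1 : B + C ≤ B * C := by nlinarith
  have h2 : 1 ≤ B * C := by omega
  cases o with
  | add => simp only [apply]; omega
  | sub => simp only [apply]; omega
  | mul => exact Nat.mul_le_mul hx hy
  | lt => simp only [apply]; split_ifs <;> omega
  | eq => simp only [apply]; split_ifs <;> omega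

lemma Expr.eval_le {n : ℕ} (hn : 0 < n) {s : State} (h : s.Bounded n) (e : Expr) :
    e.eval s ≤ (n + 1) ^ e.weight := by
  induction e with
  | const c =>
    have h1 : c + 1 < 2 ^ (c + 1) := Nat.lt_two_pow_self
    have h2 : 2 ^ (c + 1) ≤ (n + 1) ^ (c + 1) := Nat.pow_le_pow_left (by omega) _
    simp only [eval, weight]
    omega
  | reg r => simpa [eval, weight] using h.1 r
  | load a ih =>
    simp only [eval, weight]
    exact (h.2 _).trans (Nat.le_self_pow (by omega) _)
  | bin o a b iha ihb =>
    have h2 (e : Expr) : 2 ≤ (n + 1) ^ e.weight :=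
      le_trans (by omega) (Nat.le_self_pow (by have := e.one_le_weight; omega) (n + 1))
    simp only [eval, weight, pow_add]
    exact Op.apply_le (h2 a) iha (h2 b) ihb o

lemma Expr.fits {n : ℕ} (hn : 0 < n) {s : State} (h : s.Bounded n) {k : ℕ} (e : Expr)
    (hk : e.weight < k) : e.Fits ((n + 1) ^ k) s := by
  have hlt : e.eval s < (n + 1) ^ k :=
    (e.eval_le hn h).trans_lt (Nat.pow_lt_pow_right (by omega) hk)
  induction e with
  | const c => exact hlt
  | reg r => exact hlt
  | load a ih =>
    simp only [weight] at hk
    exact ⟨ih (by omega) ((a.eval_le hn h).trans_lt (Nat.pow_lt_pow_right (by omega) (by omega))),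
      hlt⟩
  | bin o a b iha ihb =>
    have ha := a.one_le_weight
    have hb := b.one_le_weight
    simp only [weight] at hk
    exact ⟨iha (by omega) ((a.eval_le hn h).trans_lt (Nat.pow_lt_pow_right (by omega) (by omega))),
      ihb (by omega) ((b.eval_le hn h).trans_lt (Nat.pow_lt_pow_right (by omega) (by omega))), hlt⟩

lemma eval_le_of_small {n : ℕ} (hn : 0 < n) {s : State} (h : s.Bounded n) {e : Expr}
    (he : Cmd.small e) : e.eval s ≤ n + 1 := by
  match e, he with
  | .const c, he =>
    simp only [Cmd.small, decide_eq_true_eq] at he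
    simp only [Expr.eval]
    omega
  | .reg r, _ => exact h.1 r
  | .load a, _ => exact h.2 _
  | .bin .lt a b, _ =>
    simp only [Expr.eval, Op.apply]
    split_ifs <;> omega
  | .bin .eq a b, _ =>
    simp only [Expr.eval, Op.apply]
    split_ifs <;> omega

namespace Cmd

/-- A command leaves alone all registers that it does not mention as a target. -/
lemma exec_reg {r : ℕ} (c : Cmd) (h : r ∉ c.writes) (s : State) :
    (c.exec s).reg r = s.reg r := by
  induction c generalizing s with
  | assign r' e => exact set_reg_of_ne _ _ (by simpa [writes] using h)
  | store a e => rfl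
  | seq c d ihc ihd =>
    simp only [writes, List.mem_append, not_or] at h
    exact (ihd h.2 _).trans (ihc h.1 s)
  | ite e c d ihc ihd =>
    simp only [writes, List.mem_append, not_or] at h
    simp only [exec]
    split_ifs
    · exact ihc h.1 s
    · exact ihd h.2 s
  | skip => rfl
  | iter r' c ih =>
    simp only [writes, List.mem_cons, not_or] at h
    simp only [exec]
    induction s.reg 0 with
    | zero => exact set_reg_of_ne _ _ h.1
    | succ k ihk => rw [iterTo, set_reg_of_ne _ _ h.1, ih h.2, ihk]

lemma zero_notMem_writes {c : Cmd} (h : c.ok) : 0 ∉ c.writes := by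
  induction c with
  | assign r e =>
    simp only [ok, Bool.and_eq_true, decide_eq_true_eq] at h
    simpa [writes] using Ne.symm h.1
  | store a e => simp [writes]
  | seq c d ihc ihd =>
    simp only [ok, Bool.and_eq_true] at h
    simp [writes, ihc h.1, ihd h.2]
  | ite e c d ihc ihd =>
    simp only [ok, Bool.and_eq_true] at h
    simp [writes, ihc h.1, ihd h.2]
  | skip => simp [writes]
  | iter r c ih =>
    simp only [ok, Bool.and_eq_true, decide_eq_true_eq] at h
    simp [writes, ih h.2, Ne.symm h.1.1]

lemma iterTo_reg_self (f : State → State) (r : ℕ) (s : State) (k : ℕ) :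
    (iterTo f r s k).reg r = k := by
  cases k <;> simp [iterTo]

lemma iterTo_reg {r r' : ℕ} (c : Cmd) (h : r' ∉ c.writes) (hr : r' ≠ r) (s : State) (k : ℕ) :
    (iterTo c.exec r s k).reg r' = s.reg r' := by
  induction k with
  | zero => exact set_reg_of_ne _ _ hr
  | succ k ih => rw [iterTo, set_reg_of_ne _ _ hr, exec_reg c h, ih]

/-- A command runs on the word RAM with the effect `exec`; the running time is polynomial of degree the
nesting depth of its loops, and words of `c.weight + 1` times the length of `n + 1` suffice. -/
theorem run_compile {n : ℕ} (hn : 0 < n) {k : ℕ} (c : Cmd) (hok : c.ok) (hk : c.weight < k)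
    (s : State) (hs : s.Bounded n) (h0 : s.reg 0 = n) :
    (c.exec s).Bounded n ∧ ∃ t, Run ((n + 1) ^ k) c.compile s t (c.exec s) ∧
      t ≤ c.size * n ^ c.depth := by
  induction c generalizing s with
  | assign r e =>
    simp only [ok, Bool.and_eq_true] at hok
    exact ⟨hs.set (eval_le_of_small hn hs hok.2) r, _, .assign s r e (e.fits hn hs hk),
      by simp [size, depth]⟩
  | store a e =>
    simp only [weight] at hk
    exact ⟨hs.write (eval_le_of_small hn hs hok) _, _,
      .store s a e (a.fits hn hs (by omega)) (e.fits hn hs (by omega)), by simp [size, depth]⟩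
  | seq c d ihc ihd =>
    simp only [ok, Bool.and_eq_true] at hok
    simp only [weight] at hk
    obtain ⟨hb, t, ht, htle⟩ := ihc hok.1 (by omega) s hs h0
    obtain ⟨hb', t', ht', htle'⟩ := ihd hok.2 (by omega) (c.exec s) hb
      ((exec_reg c (zero_notMem_writes hok.1) s).trans h0)
    refine ⟨hb', _, .seq ht ht', ?_⟩
    simp only [size, depth, add_mul]
    exact Nat.add_le_add
      (htle.trans (Nat.mul_le_mul_left _ (Nat.pow_le_pow_right hn (le_max_left _ _))))
      (htle'.trans (Nat.mul_le_mul_left _ (Nat.pow_le_pow_right hn (le_max_right _ _))))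
  | ite e c d ihc ihd =>
    simp only [ok, Bool.and_eq_true] at hok
    simp only [weight] at hk
    have hf := e.fits (k := k) hn hs (by omega)
    have hone : 1 ≤ n ^ max c.depth d.depth := Nat.one_le_pow _ _ hn
    have h1 : e.cost + 1 ≤ (e.cost + 1) * n ^ max c.depth d.depth := Nat.le_mul_of_pos_right _ hone
    simp only [exec, size, depth, add_mul _ _ (n ^ _)] at h1 ⊢
    split_ifs with he
    · obtain ⟨hb, t, ht, htle⟩ := ihc hok.1 (by omega) s hs h0
      refine ⟨hb, _, .ite_true hf he ht, ?_⟩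
      have h2 := htle.trans (Nat.mul_le_mul_left _ (Nat.pow_le_pow_right hn
        (le_max_left c.depth d.depth)))
      omega
    · obtain ⟨hb, t, ht, htle⟩ := ihd hok.2 (by omega) s hs h0
      refine ⟨hb, _, .ite_false hf (not_not.1 he) ht, ?_⟩
      have h2 := htle.trans (Nat.mul_le_mul_left _ (Nat.pow_le_pow_right hn
        (le_max_right c.depth d.depth)))
      omega
  | skip => exact ⟨hs, 1, .skip s, by simp [size, depth]⟩
  | iter r c ih =>
    simp only [ok, Bool.and_eq_true, decide_eq_true_eq] at hok
    obtain ⟨⟨hr0, hrw⟩, hokc⟩ := hok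
    simp only [weight] at hk
    have ih := ih hokc (by omega)
    set f := iterTo c.exec r s with hf
    have hf0 : ∀ j, (f j).reg 0 = n := fun j =>
      (iterTo_reg c (zero_notMem_writes hokc) (Ne.symm hr0) s j).trans h0
    have hb : ∀ j ≤ n, (f j).Bounded n := by
      intro j hj
      induction j with
      | zero => exact hs.set (by omega) r
      | succ j ihj => exact (ih _ (ihj (by omega)) (hf0 j)).1.set (by omega) r
    have hreg : ∀ j, (f j).reg r = j := iterTo_reg_self c.exec r s
    have hfit : ∀ j ≤ n, (Expr.bin .lt (.reg r) (.reg 0)).Fits ((n + 1) ^ k) (f j) := fun j hj =>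
      Expr.fits hn (hb j hj) _ (by simp only [Expr.weight]; omega)
    -- the remaining rounds
    have hloop : ∀ m j, j + m = n → ∃ t, Run ((n + 1) ^ k)
        (.loop (.bin .lt (.reg r) (.reg 0))
          (.seq c.compile (.assign r (.bin .add (.reg r) (.const 1))))) (f j) t (f n) ∧
        t ≤ m * (c.size * n ^ c.depth + 8) + 4 := by
      intro m
      induction m with
      | zero =>
        intro j hj
        obtain rfl : j = n := by omega
        refine ⟨_, .loop_false (hfit j le_rfl) ?_, by simp [Expr.cost]⟩
        simp [Expr.eval, Op.apply, hreg, hf0]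
      | succ m ihm =>
        intro j hj
        obtain ⟨hbj, t₁, ht₁, hle₁⟩ := ih (f j) (hb j (by omega)) (hf0 j)
        obtain ⟨t₂, ht₂, hle₂⟩ := ihm (j + 1) (by omega)
        have hassign := Run.assign (W := (n + 1) ^ k) (c.exec (f j)) r
          (.bin .add (.reg r) (.const 1))
          (Expr.fits hn hbj _ (by simp only [Expr.weight]; omega))
        have hev : (Expr.bin .add (.reg r) (.const 1)).eval (c.exec (f j)) = j + 1 := by
          simp [Expr.eval, Op.apply, exec_reg c hrw, hreg]
        rw [hev] at hassign
        refine ⟨_, .loop_true (hfit j (by omega)) ?_ (.seq ht₁ hassign) ht₂, ?_⟩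
        · simp only [Expr.eval, Op.apply, hreg, hf0]
          rw [if_pos (by omega)]
          exact one_ne_zero
        · simp only [Expr.cost, add_mul]
          omega
    obtain ⟨t, ht, hle⟩ := hloop n 0 (by omega)
    have hexec : (iter r c).exec s = f n := by simp only [exec, h0, hf]
    rw [hexec]
    refine ⟨hb n le_rfl, _, .seq (.assign s r (.const 0) (Expr.fits hn hs _ (by
      simp only [Expr.weight]; omega))) ht, ?_⟩
    have hpow : n ≤ n ^ (c.depth + 1) := Nat.le_self_pow (by omega) n
    have he : n * (c.size * n ^ c.depth) = c.size * n ^ (c.depth + 1) := by ring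
    simp only [Expr.cost, size, depth, add_mul, mul_add, he] at hle ⊢
    omega

end Cmd

end WordRAM

/-! ### The data in memory -/

namespace WordRAM

open Relation TreeSpanner
open scoped Classical

variable {n : ℕ} {G : SimpleGraph (Fin n)}

/-- The state `s` holds the adjacency matrix of `G`, a list `m` of marks of the vertices, and a table
`D` indexed by triples of vertices. -/
structure Represents (G : SimpleGraph (Fin n)) (D : Fin n → Fin n → Fin n → ℕ) (m : Fin n → ℕ)
    (s : State) : Prop where
  size : s.reg 0 = n
  adj : ∀ i j : Fin n, s.mem (i * n + j) = if G.Adj i j then 1 else 0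
  mark : ∀ x : Fin n, s.mem (n * n + x) = m x
  dom : ∀ u x a : Fin n, s.mem (n * n + n + ((u * n + x) * n + a)) = D u x a

lemma mul_add_lt_sq (i j : Fin n) : (i * n + j : ℕ) < n * n := by
  have := Nat.mul_le_mul_right n (Nat.succ_le_of_lt i.2)
  rw [Nat.succ_mul] at this
  omega

lemma mul_add_inj {p q : ℕ} {a b : Fin n} (h : p * n + a = q * n + b) : p = q ∧ a = b := by
  have hn : 0 < n := a.pos
  have h1 := congrArg (· / n) h
  have h2 := congrArg (· % n) h
  simp only [mul_comm _ n, Nat.mul_add_div hn, Nat.div_eq_of_lt a.2, Nat.div_eq_of_lt b.2, Nat.mul_add_mod,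
    Nat.mod_eq_of_lt a.2, Nat.mod_eq_of_lt b.2, add_zero] at h1 h2
  exact ⟨h1, Fin.ext h2⟩

namespace Represents

variable {D : Fin n → Fin n → Fin n → ℕ} {m : Fin n → ℕ} {s : State}

lemma set (h : Represents G D m s) {r : ℕ} (hr : r ≠ 0) (v : ℕ) : Represents G D m (s.set r v) where
  size := (set_reg_of_ne _ _ hr.symm).trans h.size
  adj := h.adj
  mark := h.mark
  dom := h.dom

lemma write_mark (h : Represents G D m s) (x : Fin n) (v : ℕ) :
    Represents G D (Function.update m x v) (s.write (n * n + x) v) where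
  size := h.size
  adj i j := by
    have := mul_add_lt_sq i j
    rw [← h.adj i j]
    exact Function.update_of_ne (by omega) _ _
  mark y := by
    by_cases hy : y = x
    · subst hy
      simp [State.write]
    · have : n * n + (y : ℕ) ≠ n * n + x := fun e => hy (Fin.ext (by omega))
      simp [State.write, hy, Fin.val_inj, h.mark]
  dom u y a := by
    rw [← h.dom u y a]
    exact Function.update_of_ne (by omega) _ _

lemma write_dom (h : Represents G D m s) (u x a : Fin n) (v : ℕ) :
    Represents G (fun u' x' a' => if u' = u ∧ x' = x ∧ a' = a then v else D u' x' a') m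
      (s.write (n * n + n + ((u * n + x) * n + a)) v) where
  size := h.size
  adj i j := by
    have := mul_add_lt_sq i j
    rw [← h.adj i j]
    exact Function.update_of_ne (by omega) _ _
  mark y := by
    rw [← h.mark y]
    exact Function.update_of_ne (by omega) _ _
  dom u' x' a' := by
    by_cases he : u' = u ∧ x' = x ∧ a' = a
    · obtain ⟨rfl, rfl, rfl⟩ := he
      simp [State.write]
    · rw [if_neg he, ← h.dom]
      refine Function.update_of_ne (fun e => he ?_) _ _
      obtain ⟨h1, h2⟩ := mul_add_inj (p := u' * n + x') (q := u * n + x) (Nat.add_left_cancel e)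
      obtain ⟨h3, h4⟩ := mul_add_inj h1
      exact ⟨Fin.ext h3, h4, h2⟩

end Represents

/-- The entry of the adjacency matrix at the vertices in registers `i` and `j`. -/
def adjEntry (i j : ℕ) : Expr := .load (.bin .add (.bin .mul (.reg i) (.reg 0)) (.reg j))

/-- The address of the mark of the vertex in register `x`. -/
def markAddr (x : ℕ) : Expr := .bin .add (.bin .mul (.reg 0) (.reg 0)) (.reg x)

/-- The address of the table entry at the vertices in registers `u`, `x` and `a`. -/
def domAddr (u x a : ℕ) : Expr :=
  .bin .add (.bin .add (.bin .mul (.reg 0) (.reg 0)) (.reg 0))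
    (.bin .add (.bin .mul (.bin .add (.bin .mul (.reg u) (.reg 0)) (.reg x)) (.reg 0)) (.reg a))

namespace Represents

variable {D : Fin n → Fin n → Fin n → ℕ} {m : Fin n → ℕ} {s : State} {i j k : ℕ} {u v x : Fin n}

lemma eval_adjEntry (h : Represents G D m s) (hi : s.reg i = u) (hj : s.reg j = v) :
    (adjEntry i j).eval s = if G.Adj u v then 1 else 0 := by
  simp only [adjEntry, Expr.eval, Op.apply, hi, hj, h.size, h.adj]

lemma eval_markAddr (h : Represents G D m s) (hi : s.reg i = x) :
    (markAddr i).eval s = n * n + x := by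
  simp only [markAddr, Expr.eval, Op.apply, hi, h.size]

lemma eval_mark (h : Represents G D m s) (hi : s.reg i = x) :
    (Expr.load (markAddr i)).eval s = m x := by
  rw [Expr.eval, h.eval_markAddr hi, h.mark]

lemma eval_domAddr (h : Represents G D m s) (hi : s.reg i = u) (hj : s.reg j = v)
    (hk : s.reg k = x) : (domAddr i j k).eval s = n * n + n + ((u * n + v) * n + x) := by
  simp only [domAddr, Expr.eval, Op.apply, hi, hj, hk, h.size]

lemma eval_dom (h : Represents G D m s) (hi : s.reg i = u) (hj : s.reg j = v)
    (hk : s.reg k = x) : (Expr.load (domAddr i j k)).eval s = D u v x := by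
  rw [Expr.eval, h.eval_domAddr hi hj hk, h.dom]

end Represents

/-- The negation of a truth value. -/
def Expr.not (e : Expr) : Expr := .bin .eq e (.const 0)

/-- The conjunction of two truth values. -/
def Expr.and (e f : Expr) : Expr := .bin .mul e f

/-- The disjunction of two truth values. -/
def Expr.or (e f : Expr) : Expr := .bin .add e f

lemma eval_not (e : Expr) (s : State) : e.not.eval s ≠ 0 ↔ ¬ e.eval s ≠ 0 := by
  by_cases h : e.eval s = 0 <;> simp [Expr.not, Expr.eval, Op.apply, h]

lemma eval_and (e f : Expr) (s : State) :
    (e.and f).eval s ≠ 0 ↔ e.eval s ≠ 0 ∧ f.eval s ≠ 0 := by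
  simp [Expr.and, Expr.eval, Op.apply]

lemma eval_or (e f : Expr) (s : State) :
    (e.or f).eval s ≠ 0 ↔ e.eval s ≠ 0 ∨ f.eval s ≠ 0 := by
  simp only [Expr.or, Expr.eval, Op.apply]
  omega

lemma eval_eq (e f : Expr) (s : State) :
    (Expr.bin .eq e f).eval s ≠ 0 ↔ e.eval s = f.eval s := by
  simp [Expr.eval, Op.apply]

lemma Represents.adjEntry_iff {D : Fin n → Fin n → Fin n → ℕ} {m : Fin n → ℕ} {s : State} {i j : ℕ}
    {u v : Fin n} (h : Represents G D m s) (hi : s.reg i = u) (hj : s.reg j = v) :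
    (adjEntry i j).eval s ≠ 0 ↔ G.Adj u v := by
  rw [h.eval_adjEntry hi hj]
  simp

lemma reg_eq_iff {s : State} {i j : ℕ} {u v : Fin n} (hi : s.reg i = u) (hj : s.reg j = v) :
    (Expr.bin .eq (.reg i) (.reg j)).eval s ≠ 0 ↔ u = v := by
  rw [eval_eq, Expr.eval, Expr.eval, hi, hj, Fin.val_inj]

namespace Cmd

/-- Invariants of counted loops. -/
lemma exec_iter_induction {r : ℕ} {c : Cmd} {s : State} (h0 : s.reg 0 = n) (I : ℕ → State → Prop)
    (init : I 0 (s.set r 0))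
    (step : ∀ (j : Fin n) (s' : State), s'.reg r = j →
      (∀ r', r' ∉ (iter r c).writes → s'.reg r' = s.reg r') → I j s' →
      I (j + 1) ((c.exec s').set r (j + 1))) :
    I n ((iter r c).exec s) := by
  have main : ∀ j ≤ n, I j (iterTo c.exec r s j) := by
    intro j hj
    induction j with
    | zero => exact init
    | succ j ih =>
      refine step ⟨j, hj⟩ _ (iterTo_reg_self _ _ _ _) (fun r' hr' => ?_) (ih (by omega))
      simp only [writes, List.mem_cons, not_or] at hr'
      exact iterTo_reg c hr'.2 hr'.1 s j
  rw [exec, h0]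
  exact main n le_rfl

end Cmd

/-! ### Closing a set of marked vertices under a relation -/

/-- Put a vertex with mark `1` into register `4`, or `n` if there is none. -/
def findMarked : Cmd :=
  .seq (.assign 4 (.reg 0)) (.iter 5 (.ite (.bin .eq (.load (markAddr 5)) (.const 1))
    (.assign 4 (.reg 5)) .skip))

/-- Mark all unmarked vertices `w` (in register `11`) for which `e` is nonzero. -/
def markSuccessors (e : Expr) : Cmd :=
  .iter 11 (.ite ((Expr.load (markAddr 11)).not.and e) (.store (markAddr 11) (.const 1)) .skip)

/-- Close the set of vertices with mark `1` under the relation given by `e`, which relates the vertices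
in registers `4` and `11`. The mark `2` stands for vertices whose successors have been marked. -/
def closeMarks (e : Expr) : Cmd :=
  .iter 6 (.seq findMarked (.ite (.bin .lt (.reg 4) (.reg 0))
    (.seq (.store (markAddr 4) (.const 2)) (markSuccessors e)) .skip))

section closeMarks

variable {D : Fin n → Fin n → Fin n → ℕ} {m : Fin n → ℕ} {s : State}

lemma exec_findMarked (h : Represents G D m s) :
    Represents G D m (findMarked.exec s) ∧
      (((findMarked.exec s).reg 4 = n ∧ ∀ x, m x ≠ 1) ∨
        ∃ y : Fin n, (findMarked.exec s).reg 4 = y ∧ m y = 1) := by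
  have h1 : Represents G D m (s.set 4 (s.reg 0)) := h.set (by decide) _
  have := Cmd.exec_iter_induction (r := 5) (c := .ite (.bin .eq (.load (markAddr 5)) (.const 1))
    (.assign 4 (.reg 5)) .skip) h1.size (fun j s' => Represents G D m s' ∧
      ((s'.reg 4 = n ∧ ∀ x : Fin n, x.val < j → m x ≠ 1) ∨ ∃ y : Fin n, s'.reg 4 = y ∧ m y = 1))
    ⟨h1.set (by decide) _, Or.inl ⟨by simp [State.set, h.size], by simp⟩⟩ ?_
  · refine ⟨this.1, this.2.imp (fun h => ⟨h.1, fun x => h.2 x x.2⟩) id⟩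
  · rintro j s' hj - ⟨hs', hor⟩
    have hev := eval_eq (.load (markAddr 5)) (.const 1) s'
    rw [hs'.eval_mark hj, Expr.eval] at hev
    simp only [Cmd.exec]
    split_ifs with hc
    · exact ⟨(hs'.set (by decide) _).set (by decide) _,
        Or.inr ⟨j, by simp [State.set, Expr.eval, hj], hev.1 hc⟩⟩
    · refine ⟨hs'.set (by decide) _, hor.imp (fun ⟨h4, hx⟩ => ⟨h4, fun x hxj => ?_⟩) id⟩
      rcases Nat.lt_succ_iff_lt_or_eq.1 hxj with hxj | hxj
      · exact hx x hxj
      · rw [Fin.ext hxj]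
        exact fun h => hc (hev.2 h)

lemma exec_markSuccessors {e : Expr} {R : Fin n → Fin n → Prop} {y : Fin n}
    (h : Represents G D m s)
    (he : ∀ (s' : State) (m' : Fin n → ℕ) (w : Fin n), Represents G D m' s' →
      (∀ r, r ≠ 11 → s'.reg r = s.reg r) → s'.reg 11 = w → (e.eval s' ≠ 0 ↔ R y w)) :
    Represents G D (fun w => if m w = 0 ∧ R y w then 1 else m w) ((markSuccessors e).exec s) := by
  have := Cmd.exec_iter_induction (r := 11) (c := .ite ((Expr.load (markAddr 11)).not.and e)
    (.store (markAddr 11) (.const 1)) .skip) h.size (fun j s' => Represents G D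
      (fun w => if w.val < j ∧ m w = 0 ∧ R y w then 1 else m w) s')
    (by simpa using h.set (by decide) _) ?_
  · simpa [markSuccessors] using this
  · intro j s' hj hregs hs'
    have hev := eval_and (Expr.load (markAddr 11)).not e s'
    rw [he s' _ j hs' (fun r hr => hregs r (by simpa [Cmd.writes] using hr)) hj, eval_not,
      hs'.eval_mark hj] at hev
    simp only [lt_irrefl, false_and, if_false, not_not] at hev
    simp only [Cmd.exec]
    refine Represents.set ?_ (by decide) _
    split_ifs with hc
    · have := hs'.write_mark j 1
      rw [hs'.eval_markAddr hj, Expr.eval]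
      convert this using 2 with w
      by_cases hw : w = j
      · subst hw
        simp [hev.1 hc]
      · have : (w : ℕ) < j + 1 ↔ (w : ℕ) < j := by
          have := Fin.val_ne_of_ne hw
          omega
        simp [hw, this]
    · convert hs' using 2 with w
      by_cases hw : w = j
      · subst hw
        have := mt hev.2 hc
        simp [this]
      · have : (w : ℕ) < j + 1 ↔ (w : ℕ) < j := by
          have := Fin.val_ne_of_ne hw
          omega
        simp [this]

lemma exec_closeMarks {e : Expr} {R : Fin n → Fin n → Prop} {S : Set (Fin n)}
    (h : Represents G D m s) (hS : ∀ x, m x = if x ∈ S then 1 else 0)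
    (he : ∀ (s' : State) (m' : Fin n → ℕ) (y w : Fin n), Represents G D m' s' →
      (∀ r, r ∉ [4, 5, 6, 11] → s'.reg r = s.reg r) → s'.reg 4 = y → s'.reg 11 = w →
      (e.eval s' ≠ 0 ↔ R y w)) :
    ∃ m', Represents G D m' ((closeMarks e).exec s) ∧
      ∀ x, m' x ≠ 0 ↔ ∃ x₀ ∈ S, ReflTransGen R x₀ x := by
  have := Cmd.exec_iter_induction (r := 6) (c := .seq findMarked (.ite (.bin .lt (.reg 4) (.reg 0))
    (.seq (.store (markAddr 4) (.const 2)) (markSuccessors e)) .skip)) h.size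
    (fun j s' => ∃ m', Represents G D m' s' ∧ (∀ x, m' x ≤ 2) ∧ (∀ x ∈ S, m' x ≠ 0) ∧
      (∀ x, m' x ≠ 0 → ∃ x₀ ∈ S, ReflTransGen R x₀ x) ∧
      (∀ y w, m' y = 2 → R y w → m' w ≠ 0) ∧
      (j ≤ (Finset.univ.filter fun x => m' x = 2).card ∨ ∀ x, m' x ≠ 1)) ?_ ?_
  · obtain ⟨m', h1, h2, h3, h4, h5, h6⟩ := this
    refine ⟨m', h1, fun x => ⟨h4 x, ?_⟩⟩
    -- after `n` rounds no mark `1` is left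
    have h7 : ∀ x, m' x ≠ 1 := by
      rcases h6 with h6 | h6
      · intro x hx
        have : (Finset.univ.filter fun x => m' x = 2) ⊂ Finset.univ := by
          refine Finset.ssubset_univ_iff.2 fun heq => ?_
          have := Finset.mem_univ x
          rw [← heq, Finset.mem_filter, hx] at this
          exact absurd this.2 (by decide)
        have := Finset.card_lt_card this
        rw [Finset.card_univ, Fintype.card_fin] at this
        omega
      · exact h6
    rintro ⟨x₀, hx₀, hr⟩
    induction hr with
    | refl => exact h3 x₀ hx₀
    | @tail y w _ hyw ih =>
      refine h5 y w ?_ hyw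
      have := h2 y
      have := h7 y
      omega
  · refine ⟨m, h.set (by decide) _, fun x => ?_, fun x hx => ?_, fun x hx => ?_, fun y w hy => ?_,
      Or.inl (Nat.zero_le _)⟩
    · rw [hS]
      split_ifs
      · exact one_le_two
      · exact zero_le_two
    · simp [hS, hx]
    · exact ⟨x, by simpa [hS] using hx, .refl⟩
    · rw [hS] at hy
      split_ifs at hy
      omega
  · rintro j s' - hregs ⟨m', h1, h2, h3, h4, h5, h6⟩
    obtain ⟨g1, g2⟩ := exec_findMarked h1
    have hlt : (Expr.bin .lt (.reg 4) (.reg 0)).eval (findMarked.exec s') ≠ 0 ↔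
        (findMarked.exec s').reg 4 < n := by simp [Expr.eval, Op.apply, g1.size]
    simp only [Cmd.exec]
    rcases g2 with ⟨g4, g2⟩ | ⟨y, g4, g2⟩
    · rw [if_neg (by rw [hlt]; omega)]
      exact ⟨m', g1.set (by decide) _, h2, h3, h4, h5, Or.inr g2⟩
    · rw [if_pos (by rw [hlt]; omega), g1.eval_markAddr g4]
      have k1 := g1.write_mark y 2
      have k2 := exec_markSuccessors (e := e) (R := R) (y := y) k1 ?_
      · refine ⟨_, k2.set (by decide) _, fun x => ?_, fun x hx => ?_, fun x hx => ?_,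
          fun z w hz hzw => ?_, ?_⟩
        · have := h2 x
          by_cases hx : x = y
          · simp [hx]
          · simp only [Function.update_of_ne hx]
            split_ifs <;> omega
        · have := h3 x hx
          by_cases hx : x = y <;> simp [hx, this]
        · by_cases hxy : x = y
          · exact h4 x (by rw [hxy, g2]; decide)
          · simp only [Function.update_of_ne hxy] at hx
            by_cases hc : m' x = 0 ∧ R y x
            · obtain ⟨x₀, hx₀, hr⟩ := h4 y (by rw [g2]; decide)
              exact ⟨x₀, hx₀, hr.tail hc.2⟩
            · rw [if_neg hc] at hx
              exact h4 x hx
        · by_cases hw : w = y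
          · simp [hw]
          · simp only [Function.update_of_ne hw]
            by_cases hzy : z = y
            · subst hzy
              by_cases hm : m' w = 0 <;> simp [hm, hzw]
            · simp only [Function.update_of_ne hzy] at hz
              have := h5 z w (by split_ifs at hz <;> omega) hzw
              simp [this]
        · rcases h6 with h6 | h6
          · left
            refine (Nat.succ_le_succ h6).trans ?_
            rw [Nat.succ_le_iff]
            refine Finset.card_lt_card ⟨fun x hx => ?_, fun hsub => ?_⟩
            · simp only [Finset.mem_filter, Finset.mem_univ, true_and] at hx ⊢
              have hxy : x ≠ y := by
                rintro rfl
                omega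
              simp [hxy, hx]
            · have hy : y ∈ Finset.univ.filter fun x => m' x = 2 := hsub (by simp)
              simp only [Finset.mem_filter, Finset.mem_univ, true_and] at hy
              omega
          · exact absurd g2 (h6 y)
      · intro s'' m'' w hs'' hr'' hw
        refine he s'' m'' y w hs'' (fun r hr => ?_) ?_ hw
        · simp only [List.mem_cons, List.not_mem_nil, or_false, not_or] at hr
          rw [hr'' r hr.2.2.2, write_reg, Cmd.exec_reg _ (by simp [findMarked, Cmd.writes, hr]),
            hregs r (by simp [Cmd.writes, findMarked, markSuccessors, hr])]
        · rw [hr'' 4 (by decide), write_reg, g4]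

end closeMarks

end WordRAM

/-! ### The table of dominating neighbours -/

namespace WordRAM

open Relation TreeSpanner
open scoped Classical

variable {n : ℕ} {G : SimpleGraph (Fin n)} {D : Fin n → Fin n → Fin n → ℕ} {m : Fin n → ℕ}
  {s : State}

/-- The vertex `a` is adjacent to `u` and to all vertices of the component of `x` in the graph induced on
the non-neighbours of `u`. -/
def DominatedBy (G : SimpleGraph (Fin n)) (u x a : Fin n) : Prop :=
  G.Adj u a ∧ ∀ y, ReflTransGen (Away G u) x y → G.Adj a y

/-- Mark the vertex in register `3`, and no other vertex. -/
def markSingle : Cmd := .iter 5 (.store (markAddr 5) (.bin .eq (.reg 5) (.reg 3)))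

/-- The relation `Away` for the vertex in register `1`. -/
def awayExpr : Expr :=
  (adjEntry 4 11).and ((Expr.bin .eq (.reg 11) (.reg 1)).not.and (adjEntry 1 11).not)

/-- Compute one table entry from the marks. -/
def fillEntry : Cmd :=
  .seq (.assign 8 (adjEntry 1 7)) (.seq
    (.iter 5 (.ite ((Expr.load (markAddr 5)).and (adjEntry 7 5).not) (.assign 8 (.const 0)) .skip))
    (.store (domAddr 1 3 7) (.reg 8)))

/-- Compute the table of the relation `DominatedBy`. -/
def fillTable : Cmd :=
  .iter 1 (.iter 3 (.seq markSingle (.seq (closeMarks awayExpr) (.iter 7 fillEntry))))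

/-- Storing marks one by one. -/
lemma exec_iter_mark {r : ℕ} (hr : r ≠ 0) {c : Cmd} {f : Fin n → ℕ} (h : Represents G D m s)
    (hc : ∀ (j : Fin n) (s' : State) (m' : Fin n → ℕ), s'.reg r = j →
      (∀ r', r' ∉ (Cmd.iter r c).writes → s'.reg r' = s.reg r') → Represents G D m' s' →
      Represents G D (Function.update m' j (f j)) (c.exec s')) :
    Represents G D f ((Cmd.iter r c).exec s) := by
  have := Cmd.exec_iter_induction (r := r) (c := c) h.size
    (fun j s' => Represents G D (fun w => if w.val < j then f w else m w) s')
    (by simpa using h.set hr _) ?_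
  · simpa using this
  · intro j s' hj hregs hs'
    refine Represents.set ?_ hr _
    convert hc j s' _ hj hregs hs' using 2 with w
    by_cases hw : w = j
    · subst hw
      simp
    · have : (w : ℕ) < j + 1 ↔ (w : ℕ) < j := by
        have := Fin.val_ne_of_ne hw
        omega
      simp [hw, this]

lemma exec_markSingle {x : Fin n} (h : Represents G D m s) (h3 : s.reg 3 = x) :
    Represents G D (fun w => if w = x then 1 else 0) (markSingle.exec s) := by
  refine exec_iter_mark (by decide) h fun j s' m' hj hregs hs' => ?_
  convert hs'.write_mark j _ using 1
  simp only [Cmd.exec]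
  rw [hs'.eval_markAddr hj]
  simp only [Expr.eval, Op.apply, hj, hregs 3 (by simp [Cmd.writes]), h3, Fin.val_inj]

lemma exec_closeAway {u x : Fin n} (h : Represents G D m s) (h1 : s.reg 1 = u)
    (hm : ∀ w, m w = if w = x then 1 else 0) :
    ∃ m', Represents G D m' ((closeMarks awayExpr).exec s) ∧
      ∀ w, m' w ≠ 0 ↔ ReflTransGen (Away G u) x w := by
  have := exec_closeMarks (R := Away G u) (S := {x}) (e := awayExpr) h
    (fun w => by simp [hm]) fun s' m' y w hs' hr h4 h11 => by
      have h1' := (hr 1 (by decide)).trans h1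
      rw [awayExpr, eval_and, eval_and, eval_not, eval_not, hs'.adjEntry_iff h4 h11,
        hs'.adjEntry_iff h1' h11, reg_eq_iff h11 h1', Away]
  simpa using this

lemma exec_fillEntry {u x a : Fin n} (h : Represents G D m s) (h1 : s.reg 1 = u) (h3 : s.reg 3 = x)
    (h7 : s.reg 7 = a) (hm : ∀ w, m w ≠ 0 ↔ ReflTransGen (Away G u) x w) :
    Represents G (fun u' x' a' => if u' = u ∧ x' = x ∧ a' = a then
      (if DominatedBy G u x a then 1 else 0) else D u' x' a') m (fillEntry.exec s) := by
  set c : Cmd := .ite ((Expr.load (markAddr 5)).and (adjEntry 7 5).not) (.assign 8 (.const 0)) .skip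
    with hc
  set s₁ := s.set 8 ((adjEntry 1 7).eval s) with hs₁
  have g : Represents G D m s₁ := h.set (by decide) _
  have g8 : s₁.reg 8 = if G.Adj u a then 1 else 0 := by
    rw [hs₁, set_reg_self, h.eval_adjEntry h1 h7]
  have := Cmd.exec_iter_induction (r := 5) (c := c) g.size
    (fun j s' => Represents G D m s' ∧ s'.reg 8 =
      if G.Adj u a ∧ ∀ y : Fin n, y.val < j → m y ≠ 0 → G.Adj a y then 1 else 0)
    ⟨g.set (by decide) _, by rw [set_reg_of_ne _ _ (by decide), g8]; simp⟩ ?_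
  · obtain ⟨k, k8⟩ := this
    have kr : ∀ r, r ≠ 5 → r ≠ 8 → ((Cmd.iter 5 c).exec s₁).reg r = s.reg r := fun r h5 h8 => by
      rw [Cmd.exec_reg _ (by simp [Cmd.writes, hc, h5, h8]), hs₁, set_reg_of_ne _ _ h8]
    have := k.write_dom u x a (((Cmd.iter 5 c).exec s₁).reg 8)
    change Represents _ _ _ (((Cmd.iter 5 c).exec s₁).write
      ((domAddr 1 3 7).eval ((Cmd.iter 5 c).exec s₁)) (((Cmd.iter 5 c).exec s₁).reg 8))
    rw [k.eval_domAddr ((kr 1 (by decide) (by decide)).trans h1)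
      ((kr 3 (by decide) (by decide)).trans h3) ((kr 7 (by decide) (by decide)).trans h7)]
    have hval : (if DominatedBy G u x a then 1 else 0) = ((Cmd.iter 5 c).exec s₁).reg 8 := by
      rw [k8]
      exact if_congr (by simp [DominatedBy, hm]) rfl rfl
    rwa [hval]
  · rintro j s' hj hregs ⟨hs', h8'⟩
    have h7' : s'.reg 7 = a := by
      rw [hregs 7 (by simp [Cmd.writes, hc]), hs₁, set_reg_of_ne _ _ (by decide), h7]
    have hev := eval_and (.load (markAddr 5)) (adjEntry 7 5).not s'
    rw [eval_not, hs'.eval_mark hj, hs'.adjEntry_iff h7' hj] at hev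
    have hsucc : (∀ y : Fin n, y.val < j + 1 → m y ≠ 0 → G.Adj a y) ↔
        (∀ y : Fin n, y.val < j → m y ≠ 0 → G.Adj a y) ∧ (m j ≠ 0 → G.Adj a j) := by
      refine ⟨fun h => ⟨fun y hy => h y (by omega), h j (by omega)⟩, fun h y hy => ?_⟩
      rcases Nat.lt_succ_iff_lt_or_eq.1 hy with hy | hy
      · exact h.1 y hy
      · rw [Fin.ext hy]
        exact h.2
    rw [set_reg_of_ne _ _ (by decide)]
    simp only [hc, Cmd.exec]
    by_cases hcond : ((Expr.load (markAddr 5)).and (adjEntry 7 5).not).eval s' ≠ 0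
    · rw [if_pos hcond]
      refine ⟨(hs'.set (by decide) _).set (by decide) _, ?_⟩
      rw [set_reg_self, if_neg]
      · rfl
      · rw [hsucc]
        exact fun h => (hev.1 hcond).2 (h.2.2 (hev.1 hcond).1)
    · rw [if_neg hcond]
      refine ⟨hs'.set (by decide) _, ?_⟩
      have : m j ≠ 0 → G.Adj a j := fun h0 => by_contra fun h1 => hcond (hev.2 ⟨h0, h1⟩)
      rw [h8']
      exact if_congr (by rw [hsucc, and_iff_left this]) rfl rfl

/-- The table is correct at all triples before `(u, x, a)` in the lexicographic order. -/
def TableUpTo (G : SimpleGraph (Fin n)) (D : Fin n → Fin n → Fin n → ℕ) (u x a : ℕ) : Prop :=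
  ∀ u' x' a' : Fin n, (u' < u ∨ u' = u ∧ (x' < x ∨ x' = x ∧ a' < a) : Prop) →
    D u' x' a' = if DominatedBy G u' x' a' then 1 else 0

lemma exec_fillTable (h : Represents G D m s) :
    ∃ m', Represents G (fun u x a => if DominatedBy G u x a then 1 else 0) m'
      (fillTable.exec s) := by
  have := Cmd.exec_iter_induction (r := 1)
    (c := .iter 3 (.seq markSingle (.seq (closeMarks awayExpr) (.iter 7 fillEntry)))) h.size
    (fun j s' => ∃ D' m', Represents G D' m' s' ∧ TableUpTo G D' j 0 0)
    ⟨D, m, h.set (by decide) _, fun _ _ _ h => by omega⟩ ?_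
  · obtain ⟨D', m', h', hD⟩ := this
    have hD' : D' = fun u x a => if DominatedBy G u x a then 1 else 0 := by
      funext u x a
      exact hD u x a (Or.inl u.2)
    exact ⟨m', hD' ▸ h'⟩
  rintro u s₁ hu - ⟨D₁, m₁, g₁, hD₁⟩
  have := Cmd.exec_iter_induction (r := 3)
    (c := .seq markSingle (.seq (closeMarks awayExpr) (.iter 7 fillEntry))) g₁.size
    (fun j s' => ∃ D' m', Represents G D' m' s' ∧ TableUpTo G D' u j 0)
    ⟨D₁, m₁, g₁.set (by decide) _, fun _ _ _ h => hD₁ _ _ _ (by omega)⟩ ?_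
  · obtain ⟨D', m', h', hD⟩ := this
    refine ⟨D', m', h'.set (by decide) _, fun u' x' a' h => hD _ _ _ ?_⟩
    have := x'.2
    omega
  rintro x s₂ hx hr₂ ⟨D₂, m₂, g₂, hD₂⟩
  have hu₂ : s₂.reg 1 = u := (hr₂ 1 (by decide)).trans hu
  have g₃ := exec_markSingle g₂ hx
  obtain ⟨m₄, g₄, hm₄⟩ := exec_closeAway g₃
    ((Cmd.exec_reg markSingle (by decide) s₂).trans hu₂) (fun _ => rfl)
  have hr₄ : ∀ r ∈ [1, 3], ((closeMarks awayExpr).exec (markSingle.exec s₂)).reg r = s₂.reg r := by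
    intro r hr
    simp only [List.mem_cons, List.not_mem_nil, or_false] at hr
    rcases hr with rfl | rfl <;>
      exact (Cmd.exec_reg _ (by decide) _).trans (Cmd.exec_reg _ (by decide) _)
  have := Cmd.exec_iter_induction (r := 7) (c := fillEntry) g₄.size
    (fun j s' => ∃ D', Represents G D' m₄ s' ∧ TableUpTo G D' u x j)
    ⟨D₂, g₄.set (by decide) _, hD₂⟩ ?_
  · obtain ⟨D', h', hD⟩ := this
    refine ⟨D', m₄, h'.set (by decide) _, fun u' x' a' h => hD _ _ _ ?_⟩
    have := a'.2
    omega
  rintro a s₅ ha hr₅ ⟨D₅, g₅, hD₅⟩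
  have g₆ := exec_fillEntry g₅ (((hr₅ 1 (by decide)).trans (hr₄ 1 (by decide))).trans hu₂)
    (((hr₅ 3 (by decide)).trans (hr₄ 3 (by decide))).trans hx) ha hm₄
  refine ⟨_, g₆.set (by decide) _, fun u' x' a' h => ?_⟩
  by_cases hc : u' = u ∧ x' = x ∧ a' = a
  · obtain ⟨rfl, rfl, rfl⟩ := hc
    exact if_pos ⟨rfl, rfl, rfl⟩
  · refine (if_neg hc).trans (hD₅ u' x' a' ?_)
    simp only [← Fin.val_inj] at hc
    omega

/-! ### Testing the edges -/

/-- Set register `8` to `1` if the vertex in register `3` is repelled by the vertex in register `i` of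
the edge in registers `i` and `j`, and to `0` otherwise. -/
def testRepelled (i j : ℕ) : Cmd :=
  .seq (.assign 8 (.const 0)) (.seq
    (.iter 7 (.ite ((Expr.load (domAddr i 3 7)).and (Expr.bin .eq (.reg 7) (.reg j)).not)
      (.assign 8 (.const 1)) .skip))
    (.assign 8 (.bin .lt (.const 0) ((Expr.reg 8).not.and
      ((Expr.bin .eq (.reg 3) (.reg i)).not.and (adjEntry i 3).not)))))

/-- The relation `Pull` for the vertices in registers `1` and `2`. -/
def pullExpr : Expr :=
  (adjEntry 4 11).and ((Expr.bin .eq (.reg 11) (.reg 1)).not.and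
    ((Expr.bin .eq (.reg 11) (.reg 2)).not.and ((adjEntry 1 11).not.or (adjEntry 2 4).not)))

/-- Mark the vertices repelled by the vertex in register `1`. -/
def markRepelled : Cmd := .iter 3 (.seq (testRepelled 1 2) (.store (markAddr 3) (.reg 8)))

/-- Set register `10` to `1` if no marked vertex is repelled by the vertex in register `2`, and to `0`
otherwise. -/
def testMarked : Cmd :=
  .seq (.assign 10 (.const 1)) (.iter 3 (.seq (testRepelled 2 1)
    (.ite ((Expr.reg 8).and (.load (markAddr 3))) (.assign 10 (.const 0)) .skip)))

/-- Set register `9` to `1` if the edge in registers `1` and `2` is central. -/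
def testEdge : Cmd :=
  .seq markRepelled (.seq (closeMarks pullExpr) (.seq testMarked
    (.ite (.reg 10) (.assign 9 (.const 1)) .skip)))

/-- Set register `9` to `1` if there is only one vertex or there is a central edge, and to `0`
otherwise. -/
def testEdges : Cmd :=
  .seq (.assign 9 (.bin .eq (.reg 0) (.const 1)))
    (.iter 1 (.iter 2 (.ite (adjEntry 1 2) testEdge .skip)))

/-- The table of the relation `DominatedBy`. -/
noncomputable abbrev domTable (G : SimpleGraph (Fin n)) : Fin n → Fin n → Fin n → ℕ :=
  fun u x a => if DominatedBy G u x a then 1 else 0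

lemma exec_testRepelled {i j : ℕ} {u v x : Fin n} (hi : i ∉ [7, 8]) (hj : j ∉ [7, 8])
    (h : Represents G (domTable G) m s) (hu : s.reg i = u) (hv : s.reg j = v) (hx : s.reg 3 = x) :
    Represents G (domTable G) m ((testRepelled i j).exec s) ∧
      ((testRepelled i j).exec s).reg 8 = if Repelled G u v x then 1 else 0 := by
  simp only [List.mem_cons, List.not_mem_nil, or_false, not_or] at hi hj
  set c : Cmd := .ite ((Expr.load (domAddr i 3 7)).and (Expr.bin .eq (.reg 7) (.reg j)).not)
      (.assign 8 (.const 1)) .skip with hc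
  have g : Represents G (domTable G) m (s.set 8 0) := h.set (by decide) _
  have := Cmd.exec_iter_induction (r := 7) (c := c) g.size
    (fun k s' => Represents G (domTable G) m s' ∧
      (s'.reg 8 ≠ 0 ↔ ∃ a : Fin n, a.val < k ∧ a ≠ v ∧ DominatedBy G u x a))
    ⟨g.set (by decide) _, by simp [State.set]⟩ ?_
  · obtain ⟨g₁, h8⟩ := this
    have hdom : (∃ a : Fin n, a.val < n ∧ a ≠ v ∧ DominatedBy G u x a) ↔ Dominated G u v x :=
      exists_congr fun a => and_iff_right a.2
    rw [hdom] at h8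
    have hr : ∀ r, r ≠ 7 → r ≠ 8 → ((Cmd.iter 7 c).exec (s.set 8 0)).reg r = s.reg r :=
      fun r h7 h8 => by
        rw [Cmd.exec_reg _ (by simp [Cmd.writes, hc, h7, h8]), set_reg_of_ne _ _ h8]
    have hu₁ := (hr i hi.1 hi.2).trans hu
    have hx₁ := (hr 3 (by decide) (by decide)).trans hx
    refine ⟨g₁.set (by decide) _, ?_⟩
    have hev : ((Expr.reg 8).not.and ((Expr.bin .eq (.reg 3) (.reg i)).not.and
        (adjEntry i 3).not)).eval ((Cmd.iter 7 c).exec (s.set 8 0)) ≠ 0 ↔ Repelled G u v x := by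
      rw [eval_and, eval_and, eval_not, eval_not, eval_not, reg_eq_iff hx₁ hu₁,
        g₁.adjEntry_iff hu₁ hx₁, Expr.eval, h8, Repelled]
      tauto
    simp only [testRepelled, Cmd.exec, set_reg_self]
    simp only [Expr.eval.eq_4, Op.apply, Expr.eval.eq_1]
    refine if_congr ?_ rfl rfl
    rw [← hev]
    exact Nat.pos_iff_ne_zero
  · rintro k s' hk hregs ⟨hs', h8'⟩
    have hr : ∀ r, r ≠ 7 → r ≠ 8 → s'.reg r = s.reg r := fun r h7 h8 => by
      rw [hregs r (by simp [Cmd.writes, hc, h7, h8]), set_reg_of_ne _ _ h8]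
    have hev := eval_and (.load (domAddr i 3 7)) (Expr.bin .eq (.reg 7) (.reg j)).not s'
    rw [eval_not, reg_eq_iff hk ((hr j hj.1 hj.2).trans hv),
      hs'.eval_dom ((hr i hi.1 hi.2).trans hu) ((hr 3 (by decide) (by decide)).trans hx) hk] at hev
    have hev' : (ite (DominatedBy G u x k) 1 0 ≠ 0) ↔ DominatedBy G u x k := by simp
    rw [domTable, hev'] at hev
    rw [set_reg_of_ne _ _ (by decide)]
    simp only [hc, Cmd.exec]
    split_ifs with hcond
    · refine ⟨(hs'.set (by decide) _).set (by decide) _, ?_⟩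
      rw [set_reg_self]
      exact iff_of_true one_ne_zero ⟨k, by omega, (hev.1 hcond).2, (hev.1 hcond).1⟩
    · refine ⟨hs'.set (by decide) _, h8'.trans (exists_congr fun a => and_congr_left fun ha => ?_)⟩
      have : a ≠ k := by
        rintro rfl
        exact hcond (hev.2 ⟨ha.2, ha.1⟩)
      have := Fin.val_ne_of_ne this
      omega

lemma exec_markRepelled {u v : Fin n} (h : Represents G (domTable G) m s) (hu : s.reg 1 = u)
    (hv : s.reg 2 = v) :
    Represents G (domTable G) (fun x => if x ∈ {x | Repelled G u v x} then 1 else 0)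
      (markRepelled.exec s) := by
  refine exec_iter_mark (by decide) h fun x s' m' hx hregs hs' => ?_
  obtain ⟨g, g8⟩ := exec_testRepelled (i := 1) (j := 2) (by decide) (by decide) hs'
    ((hregs 1 (by decide)).trans hu) ((hregs 2 (by decide)).trans hv) hx
  convert g.write_mark x _ using 1
  rw [Cmd.exec, Cmd.exec, g.eval_markAddr ((Cmd.exec_reg _ (by decide) _).trans hx), Expr.eval, g8]
  rfl

lemma exec_closePull {u v : Fin n} {S : Set (Fin n)} (h : Represents G D m s) (hu : s.reg 1 = u)
    (hv : s.reg 2 = v) (hm : ∀ w, m w = if w ∈ S then 1 else 0) :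
    ∃ m', Represents G D m' ((closeMarks pullExpr).exec s) ∧
      ∀ w, m' w ≠ 0 ↔ ∃ x₀ ∈ S, ReflTransGen (Pull G u v) x₀ w := by
  refine exec_closeMarks h hm fun s' m' y w hs' hr h4 h11 => ?_
  have hu' := (hr 1 (by decide)).trans hu
  have hv' := (hr 2 (by decide)).trans hv
  rw [pullExpr, eval_and, eval_and, eval_and, eval_or, eval_not, eval_not, eval_not, eval_not,
    hs'.adjEntry_iff h4 h11, hs'.adjEntry_iff hu' h11, hs'.adjEntry_iff hv' h4,
    reg_eq_iff h11 hu', reg_eq_iff h11 hv', Pull]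

lemma exec_testMarked {u v : Fin n} (h : Represents G (domTable G) m s) (hu : s.reg 1 = u)
    (hv : s.reg 2 = v) :
    Represents G (domTable G) m (testMarked.exec s) ∧
      ((testMarked.exec s).reg 10 ≠ 0 ↔ ∀ x, m x ≠ 0 → ¬ Repelled G v u x) := by
  set c : Cmd := .seq (testRepelled 2 1)
    (.ite ((Expr.reg 8).and (.load (markAddr 3))) (.assign 10 (.const 0)) .skip) with hc
  have g : Represents G (domTable G) m (s.set 10 1) := h.set (by decide) _
  have := Cmd.exec_iter_induction (r := 3) (c := c) g.size
    (fun k s' => Represents G (domTable G) m s' ∧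
      (s'.reg 10 ≠ 0 ↔ ∀ x : Fin n, x.val < k → m x ≠ 0 → ¬ Repelled G v u x))
    ⟨g.set (by decide) _, by simp [State.set]⟩ ?_
  · exact ⟨this.1, this.2.trans (forall_congr' fun x => forall_prop_of_true x.2)⟩
  · rintro x s' hx hregs ⟨hs', h10⟩
    have hu' := (hregs 1 (by decide)).trans ((set_reg_of_ne s 1 (by decide)).trans hu)
    have hv' := (hregs 2 (by decide)).trans ((set_reg_of_ne s 1 (by decide)).trans hv)
    obtain ⟨k, k8⟩ := exec_testRepelled (i := 2) (j := 1) (by decide) (by decide) hs' hv' hu' hx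
    have hev := eval_and (.reg 8) (.load (markAddr 3)) ((testRepelled 2 1).exec s')
    rw [k.eval_mark ((Cmd.exec_reg _ (by decide) _).trans hx), Expr.eval, k8] at hev
    have hev' : (ite (Repelled G v u x) 1 0 ≠ 0) ↔ Repelled G v u x := by simp
    rw [hev'] at hev
    rw [set_reg_of_ne _ _ (by decide)]
    simp only [hc, Cmd.exec]
    split_ifs with hcond
    · refine ⟨(k.set (by decide) _).set (by decide) _, ?_⟩
      rw [set_reg_self]
      exact iff_of_false (not_not.2 rfl) fun h =>
        h x (by omega) (hev.1 hcond).2 (hev.1 hcond).1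
    · refine ⟨k.set (by decide) _, ?_⟩
      rw [Cmd.exec_reg _ (by decide), h10]
      refine ⟨fun h y hy => ?_, fun h y hy => h y (by omega)⟩
      rcases Nat.lt_succ_iff_lt_or_eq.1 hy with hy | hy
      · exact h y hy
      · rw [Fin.ext hy]
        exact fun h1 h2 => hcond (hev.2 ⟨h2, h1⟩)

lemma exec_testEdge {u v : Fin n} (h : Represents G (domTable G) m s) (hu : s.reg 1 = u)
    (hv : s.reg 2 = v) (huv : G.Adj u v) :
    (∃ m', Represents G (domTable G) m' (testEdge.exec s)) ∧
      (testEdge.exec s).reg 9 = if Central G u v then 1 else s.reg 9 := by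
  have g₁ := exec_markRepelled h hu hv
  obtain ⟨m₂, g₂, hm₂⟩ := exec_closePull g₁ ((Cmd.exec_reg _ (by decide) _).trans hu)
    ((Cmd.exec_reg _ (by decide) _).trans hv) (fun _ => rfl)
  have hr₂ : ∀ r ∈ [1, 2], ((closeMarks pullExpr).exec (markRepelled.exec s)).reg r = s.reg r := by
    intro r hr
    simp only [List.mem_cons, List.not_mem_nil, or_false] at hr
    rcases hr with rfl | rfl <;>
      exact (Cmd.exec_reg _ (by decide) _).trans (Cmd.exec_reg _ (by decide) _)
  obtain ⟨g₃, h10⟩ := exec_testMarked g₂ ((hr₂ 1 (by decide)).trans hu)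
    ((hr₂ 2 (by decide)).trans hv)
  have hcentral : Central G u v ↔ ∀ x, m₂ x ≠ 0 → ¬ Repelled G v u x := by
    simp only [hm₂]
    exact and_iff_right huv
  simp only [testEdge, Cmd.exec]
  rw [Expr.eval]
  split_ifs with hc hc' hc'
  · exact ⟨⟨m₂, g₃.set (by decide) _⟩, set_reg_self _ _ _⟩
  · exact absurd (hcentral.2 (h10.1 hc)) hc'
  · exact absurd (h10.2 (hcentral.1 hc')) hc
  · refine ⟨⟨m₂, g₃⟩, ?_⟩
    exact (Cmd.exec_reg _ (by decide) _).trans ((Cmd.exec_reg _ (by decide) _).trans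
      (Cmd.exec_reg _ (by decide) _))

lemma exec_testEdges (h : Represents G (domTable G) m s) :
    (testEdges.exec s).reg 9 = if n = 1 ∨ ∃ u v, Central G u v then 1 else 0 := by
  set s₀ := s.set 9 (if n = 1 then 1 else 0) with hs₀
  have h0 : Represents G (domTable G) m s₀ := h.set (by decide) _
  have := Cmd.exec_iter_induction (r := 1) (c := .iter 2 (.ite (adjEntry 1 2) testEdge .skip))
    h0.size
    (fun k s' => ∃ m', Represents G (domTable G) m' s' ∧ s'.reg 9 =
      if n = 1 ∨ ∃ u v : Fin n, u.val < k ∧ Central G u v then 1 else 0)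
    ⟨m, h0.set (by decide) _, by simp [State.set, hs₀]⟩ ?_
  · obtain ⟨m', -, h9⟩ := this
    have hexec : testEdges.exec s =
        (Cmd.iter 1 (.iter 2 (.ite (adjEntry 1 2) testEdge .skip))).exec s₀ := by
      rw [testEdges, Cmd.exec, Cmd.exec, hs₀, Expr.eval, Expr.eval, Expr.eval, Op.apply, h.size]
    rw [hexec, h9]
    simp
  rintro u s₁ hu - ⟨m₁, g₁, h9⟩
  have := Cmd.exec_iter_induction (r := 2) (c := .ite (adjEntry 1 2) testEdge .skip) g₁.size
    (fun k s' => ∃ m', Represents G (domTable G) m' s' ∧ s'.reg 9 =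
      if n = 1 ∨ ∃ u' v' : Fin n, (u' < u ∨ u' = u ∧ v'.val < k) ∧ Central G u' v' then 1 else 0)
    ⟨m₁, g₁.set (by decide) _, by
      rw [set_reg_of_ne _ _ (by decide), h9]
      simp⟩ ?_
  · obtain ⟨m', g', h9'⟩ := this
    refine ⟨m', g'.set (by decide) _, ?_⟩
    rw [set_reg_of_ne _ _ (by decide), h9']
    refine if_congr (or_congr_right (exists_congr fun u' => exists_congr fun v' =>
      and_congr_left fun _ => ?_)) rfl rfl
    rw [Fin.lt_def, ← Fin.val_inj]
    have := v'.2
    omega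
  rintro v s₂ hv hr₂ ⟨m₂, g₂, h9₂⟩
  have hu₂ : s₂.reg 1 = u := (hr₂ 1 (by decide)).trans hu
  have hstep : (∃ u' v' : Fin n, (u' < u ∨ u' = u ∧ v'.val < v + 1) ∧ Central G u' v') ↔
      (∃ u' v' : Fin n, (u' < u ∨ u' = u ∧ v'.val < v) ∧ Central G u' v') ∨ Central G u v := by
    constructor
    · rintro ⟨u', v', h1, h2⟩
      by_cases hc : u' = u ∧ v' = v
      · exact Or.inr (hc.1 ▸ hc.2 ▸ h2)
      · refine Or.inl ⟨u', v', ?_, h2⟩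
        rw [← Fin.val_inj, ← Fin.val_inj] at hc
        rw [Fin.lt_def, ← Fin.val_inj] at h1 ⊢
        omega
    · rintro (⟨u', v', h1, h2⟩ | h)
      · exact ⟨u', v', h1.imp id (fun h => ⟨h.1, by omega⟩), h2⟩
      · exact ⟨u, v, Or.inr ⟨rfl, by omega⟩, h⟩
  simp only [hstep]
  have hev := g₂.adjEntry_iff hu₂ hv
  rw [set_reg_of_ne _ _ (by decide), Cmd.exec]
  by_cases hadj : (adjEntry 1 2).eval s₂ ≠ 0
  · rw [if_pos hadj]
    obtain ⟨⟨m', g'⟩, h'⟩ := exec_testEdge g₂ hu₂ hv (hev.1 hadj)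
    refine ⟨m', g'.set (by decide) _, ?_⟩
    rw [h', h9₂]
    by_cases hC : Central G u v
    · rw [if_pos hC, if_pos (Or.inr (Or.inr hC))]
    · rw [if_neg hC]
      exact if_congr (by simp only [hC, or_false]) rfl rfl
  · rw [if_neg hadj]
    refine ⟨m₂, g₂.set (by decide) _, h9₂.trans ?_⟩
    have hC : ¬ Central G u v := fun h => hadj (hev.2 h.1)
    exact if_congr (by simp only [hC, or_false]) rfl rfl

/-! ### The algorithm -/

/-- The algorithm, up to putting its answer from register `9` into register `0`. -/
def decideCmd : Cmd := .seq fillTable testEdges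

lemma inputState_bounded : (inputState G).Bounded n := by
  refine ⟨fun r => ?_, fun a => ?_⟩
  · simp only [inputState]
    split_ifs <;> omega
  · simp only [inputState]
    split_ifs <;> omega

lemma inputState_represents : Represents G
    (fun u x a => (inputState G).mem (n * n + n + ((u * n + x) * n + a)))
    (fun x => (inputState G).mem (n * n + x)) (inputState G) where
  size := rfl
  adj i j := by
    simp only [inputState]
    refine if_congr ⟨?_, fun h => ⟨i, j, rfl, h⟩⟩ rfl rfl
    rintro ⟨i', j', h1, h2⟩
    obtain ⟨h3, rfl⟩ := mul_add_inj h1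
    rwa [Fin.ext h3]
  mark _ := rfl
  dom _ _ _ := rfl

lemma decideCmd_reg : (decideCmd.exec (inputState G)).reg 9 =
    if n = 1 ∨ ∃ u v, Central G u v then 1 else 0 := by
  obtain ⟨m', h'⟩ := exec_fillTable (inputState_represents (G := G))
  exact exec_testEdges h'

lemma central_iff_admitsTreeSpanner (hn : 0 < n) (hG : G.ediam ≤ 3) :
    (n = 1 ∨ ∃ u v, Central G u v) ↔ AdmitsTreeSpanner 3 G := by
  constructor
  · rintro (rfl | ⟨u, v, h⟩)
    · exact ⟨⊥, bot_le, .of_subsingleton, fun u v => by simp [Subsingleton.elim u v]⟩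
    · exact h.admitsTreeSpanner
  · rintro ⟨T, hT⟩
    by_cases h1 : n = 1
    · exact Or.inl h1
    have : Nontrivial (Fin n) := Fin.nontrivial_iff_two_le.2 (by omega)
    refine Or.inr (exists_central_of_isTreeSpanner (hT.2.1.connected.mono hT.1) (fun x y => ?_) hT)
    have h3 : G.edist x y ≤ 3 := SimpleGraph.edist_le_ediam.trans hG
    exact ENat.toNat_le_of_le_natCast h3

end WordRAM

theorem theoremt :
    ∃ (P : WordRAM.Prog) (k C : ℕ), ∀ (n : ℕ), 0 < n → ∀ (G : SimpleGraph (Fin n)),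
      ∃ (t : ℕ) (s : WordRAM.State),
        WordRAM.Run ((n + 1) ^ k) P (WordRAM.inputState G) t s ∧
        t ≤ C * n ^ 4 ∧
        (G.ediam ≤ 3 →
          (TreeSpanner.AdmitsTreeSpanner 3 G → s.reg 0 = 1) ∧
          (¬ TreeSpanner.AdmitsTreeSpanner 3 G → s.reg 0 = 0)) := by
  refine ⟨.seq WordRAM.decideCmd.compile (.assign 0 (.reg 9)), WordRAM.decideCmd.weight + 2,
    WordRAM.decideCmd.size + 2, fun n hn G => ?_⟩
  obtain ⟨hb, t, ht, hle⟩ := WordRAM.Cmd.run_compile hn (k := WordRAM.decideCmd.weight + 2)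
    WordRAM.decideCmd (by decide) (by omega) (WordRAM.inputState G) WordRAM.inputState_bounded rfl
  refine ⟨_, _, .seq ht (.assign _ 0 (.reg 9) (WordRAM.Expr.fits hn hb _ ?_)), ?_, fun hG => ?_⟩
  · simp only [WordRAM.Expr.weight]
    omega
  · have hd : WordRAM.decideCmd.depth = 4 := by decide
    rw [hd] at hle
    have : 1 ≤ n ^ 4 := Nat.one_le_pow _ _ hn
    simp only [WordRAM.Expr.cost, add_mul]
    omega
  · rw [← WordRAM.central_iff_admitsTreeSpanner hn hG]
    simp only [WordRAM.Expr.eval, Function.update_self, WordRAM.decideCmd_reg]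
    exact ⟨fun h => if_pos h, fun h => if_neg h⟩
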